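/- Let $\mathbf p=(p_1,\dots,p_k)$ be a probability distribution, $C(\mathbf p)=\sum_i p_i^2$ its collision probability, and $c_0\in\mathbb R$. Let $\alpha>0$, $\beta,\delta\in(0,1]$. **Mechanism.** Put $r=\big\lceil 6\big(\frac{e^\alpha+1}{e^\alpha-1}\big)^2\log\frac4\beta\big\rceil$. A run of the mechanism with expected number of users $n$, precision $w\in(0,1]$ and failure probability $\delta'\in(0,1)$ uses $a=\lceil 8\log\frac1{\delta'}\rceil$ supergroups of $b=\lceil 20/w^2\rceil$ groups each, $g=ab$, $m=n/g$. The server draws independent group sizes $N_j\sim\mathrm{Poisson}(m)$, $1\le j\le g$, assigns users to the groups, and sends them a uniformly random hash function $h$ with values in $\{-1,+1\}$. A user of group $j$ with sample $x$ privately chooses a uniform salt $s\in\{1,\dots,r\}$ and sends $h(j,s,x)$. With $V_j$ the sum of the hash values of group $j$ and $C_j=r(V_j^2-m)/m^2$, the estimate $\hat C$ is the median over the supergroups of the mean of the $C_j$ in the supergroup. **Doubling Tester.** In rounds $t=0,1,2,\dots$ run the mechanism with fresh users and fresh independent randomness, with $\delta_t=\delta/2^{t+1}$, $a_t=\lceil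 8\log\frac1{\delta_t}\rceil$, $n_t=160\,a_0\,r\,2^t$ and $w_t=\sqrt{160\,a_t\,r/n_t}$; let $\hat C_t$ be its estimate. Reject the null hypothesis and stop as soon as $|\hat C_t-c_0|>w_t$. All users' samples are drawn independently from $\mathbf p$. **Theorem.** 1. The Doubling Tester is $(\alpha,\beta)$-locally differentially private: if $x,x'$ are two assignments of samples to the users $0,1,2,\dots$ that differ only in the sample of one user, then for every measurable set $\mathcal O$ of transcripts (the group sizes, hash functions and hash values of all rounds that are run, and the information which rounds are run), $\Pr[M(x)\in\mathcal O]\le e^\alpha\Pr[M(x')\in\mathcal O]+\beta$. 2. If $C(\mathbf p)=c_0$, then with probability at least $1-\delta$ the Doubling Tester never rejects. 3. For every $\kappa\in(0,1)$ there is a constant $K>0$, depending on $\kappa$ only, such that whenever $\beta,\delta\in(0,\kappa]$, $\varepsilon\in(0,\kappa]$ and $|C(\mathbf p)-c_0|\ge\varepsilon$, the Doubling Tester, with probability at least $1-\delta$, rejects after observing at most $$K\Big(\frac{e^\alpha+1}{e^\alpha-1}\Big)^2\,\frac{\log^2\frac1\varepsilon\,\log\frac1\beta\,\log\frac1\delta}{\varepsilon^2}$$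 samples, and if $\alpha\le1$, also with probability at least $1-\delta$, it rejects after observing at most $K\,\frac{\log^2\frac1\varepsilon\,\log\frac1\beta\,\log\frac1\delta}{\alpha^2\varepsilon^2}$ samples. -/

import Mathlib

open MeasureTheory ProbabilityTheory

namespace CollisionTest

noncomputable section

/-- The collision probability `C(p) = ∑ i, p i ^ 2`. -/
def collisionProb {k : ℕ} (p : PMF (Fin k)) : ℝ := ∑ i, (p i).toReal ^ 2

/-- The median of `f 0, …, f (a - 1)`: the middle entry of the sorted list, and the average of
the two middle entries when `a` is even. -/
def median (a : ℕ) (f : ℕ → ℝ) : ℝ :=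
  let L := ((List.range a).map f).insertionSort (· ≤ ·)
  (L.getD ((a - 1) / 2) 0 + L.getD (a / 2) 0) / 2

/-- Local differential privacy of a randomized interactive protocol `M` whose internal randomness
has law `μ`, for a population of users `0, 1, 2, …`; user `i` holds the sample `x i`. The output
`M x ω` is the whole communication transcript. Changing the sample of one user changes the
probability of any event about the transcript by at most a factor `exp α` and a summand `β`. -/
def IsLDP {Ω X T : Type*} [MeasurableSpace Ω] [MeasurableSpace T]
    (α β : ℝ) (μ : Measure Ω) (M : (ℕ → X) → Ω → T) : Prop :=
  ∀ (i : ℕ) (x x' : ℕ → X), (∀ j, j ≠ i → x' j = x j) →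
    ∀ O : Set T, MeasurableSet O →
      μ {ω | M x ω ∈ O} ≤
        ENNReal.ofReal (Real.exp α) * μ {ω | M x' ω ∈ O} + ENNReal.ofReal β

/-! ### One run of the hashing mechanism -/

/-- The number `r` of salts, `6 ((e^α + 1) / (e^α - 1))² log (4 / β)` rounded up (for `α > 0` and
`0 < β ≤ 1` the maximum with `1` has no effect). -/
def numSalts (α β : ℝ) : ℕ :=
  max 1 ⌈6 * ((Real.exp α + 1) / (Real.exp α - 1)) ^ 2 * Real.log (4 / β)⌉₊

instance (α β : ℝ) : NeZero (numSalts α β) :=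
  ⟨Nat.one_le_iff_ne_zero.mp (le_max_left _ _)⟩

/-- The number `a` of supergroups for failure probability `δ`. -/
def numSupergroups (δ : ℝ) : ℕ := ⌈8 * Real.log (1 / δ)⌉₊

/-- The number `b` of groups in each supergroup for precision parameter `w`. -/
def groupsPerSupergroup (w : ℝ) : ℕ := ⌈20 / w ^ 2⌉₊

/-- A hash function, applied to triples (group index, salt, sample). -/
abbrev Hash (r k : ℕ) : Type := ℕ × Fin r × Fin k → ℤˣ

/-- The transcript of one run: the group sizes (which tell each user the assigned group), the hash
function sent by the server, and the hash values sent by the users; the value at `(j, i)` is that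
of the `i`-th user of group `j`, and it is `1` by convention if there is no such user. -/
abbrev RunTranscript (r k : ℕ) : Type := (ℕ → ℕ) × Hash r k × (ℕ × ℕ → ℤˣ)

/-- Users are assigned to groups consecutively: the number of the `i`-th user of group `j`. -/
def member (N : ℕ → ℕ) (j i : ℕ) : ℕ := (∑ l ∈ Finset.range j, N l) + i

/-- The transcript of a run with `g` groups of sizes `N 0, …, N (g - 1)`, hash function `h`, where
the user with number `u` has salt `s u` and sample `x u`: this user sends `h (j, s u, x u)`, with
`j` the assigned group. -/
def runTranscript {r k : ℕ} (g : ℕ) (N : ℕ → ℕ) (h : Hash r k) (s : ℕ → Fin r) (x : ℕ → Fin k) :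
    RunTranscript r k :=
  (fun j => if j < g then N j else 0, h,
    fun q => if q.1 < g ∧ q.2 < N q.1 then h (q.1, s (member N q.1 q.2), x (member N q.1 q.2))
      else 1)

/-- The sum `V j` of the hash values of group `j`. -/
def groupSum {r k : ℕ} (T : RunTranscript r k) (j : ℕ) : ℝ :=
  ∑ i ∈ Finset.range (T.1 j), ((T.2.2 (j, i) : ℤ) : ℝ)

/-- The bias-corrected estimate `C j = r (V j ^ 2 - m) / m ^ 2` of group `j`, where `m` is the
expected group size. -/
def groupEstimate {r k : ℕ} (m : ℝ) (T : RunTranscript r k) (j : ℕ) : ℝ :=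
  r * (groupSum T j ^ 2 - m) / m ^ 2

/-- The estimate which the server computes from the transcript: the median over the `a`
supergroups of the mean of the estimates of the `b` groups in the supergroup. -/
def estimate {r k : ℕ} (a b : ℕ) (m : ℝ) (T : RunTranscript r k) : ℝ :=
  median a fun l => (1 / (b : ℝ)) * ∑ j ∈ Finset.range b, groupEstimate m T (l * b + j)

/-! ### The Doubling Tester

Round `t = 0, 1, 2, …` is a run of the mechanism on fresh users, with fresh randomness, with
expected number of users `sampleSize t`, failure probability `failProb t` and precision
`radius t`. The tester rejects at the end of the first round where the estimate is further than
`radius t` from `c₀`. -/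

/-- The failure probability `δ / 2 ^ (t + 1)` allotted to round `t`; these sum to `δ`. -/
def failProb (δ : ℝ) (t : ℕ) : ℝ := δ / 2 ^ (t + 1)

/-- The expected number of users in round `t`; it doubles from each round to the next. -/
def sampleSize (α β δ : ℝ) (t : ℕ) : ℝ :=
  160 * numSupergroups (failProb δ 0) * numSalts α β * 2 ^ t

/-- The half-width of the confidence interval of round `t`, `√(160 a r / n)`. -/
def radius (α β δ : ℝ) (t : ℕ) : ℝ :=
  Real.sqrt (160 * numSupergroups (failProb δ t) * numSalts α β / sampleSize α β δ t)

/-- The number `a` of supergroups in round `t`. -/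
def roundSupergroups (δ : ℝ) (t : ℕ) : ℕ := numSupergroups (failProb δ t)

/-- The number `b` of groups per supergroup in round `t`. -/
def roundGroupsPer (α β δ : ℝ) (t : ℕ) : ℕ := groupsPerSupergroup (radius α β δ t)

/-- The number `g = a b` of groups in round `t`. -/
def roundGroups (α β δ : ℝ) (t : ℕ) : ℕ := roundSupergroups δ t * roundGroupsPer α β δ t

/-- The expected group size `m = n / g` in round `t`. -/
def roundRate (α β δ : ℝ) (t : ℕ) : ℝ := sampleSize α β δ t / roundGroups α β δ t

/-- The internal randomness of the tester: the size of group `j` in round `t`, the hash function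
of round `t`, and the salt of user `u`. -/
abbrev Seed (r k : ℕ) : Type :=
  (ℕ × ℕ → ℕ) × (ℕ × ℕ × Fin r × Fin k → ℤˣ) × (ℕ → Fin r)

/-- Group sizes are Poisson, hash values of distinct arguments are uniform signs, salts are
uniform, and all these are independent. -/
def seedLaw (k : ℕ) (α β δ : ℝ) : Measure (Seed (numSalts α β) k) :=
  (Measure.infinitePi fun q : ℕ × ℕ => poissonMeasure (roundRate α β δ q.1).toNNReal).prod
    ((Measure.infinitePi fun _ : ℕ × ℕ × Fin (numSalts α β) × Fin k =>
        uniformOn (Set.univ : Set ℤˣ)).prod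
      (Measure.infinitePi fun _ : ℕ => uniformOn (Set.univ : Set (Fin (numSalts α β)))))

instance (k : ℕ) (α β δ : ℝ) : IsProbabilityMeasure (seedLaw k α β δ) := by
  unfold seedLaw; infer_instance

/-- The joint law of the internal randomness and of the users' samples, which are drawn
independently from `p`. -/
def fullLaw {k : ℕ} (p : PMF (Fin k)) (α β δ : ℝ) :
    Measure (Seed (numSalts α β) k × (ℕ → Fin k)) :=
  (seedLaw k α β δ).prod (Measure.infinitePi fun _ : ℕ => p.toMeasure)

instance {k : ℕ} (p : PMF (Fin k)) (α β δ : ℝ) : IsProbabilityMeasure (fullLaw p α β δ) := by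
  unfold fullLaw; infer_instance

/-- The number of users who take part in the rounds before round `t`. -/
def usersBefore {k : ℕ} (α β δ : ℝ) (ω : Seed (numSalts α β) k) (t : ℕ) : ℕ :=
  ∑ u ∈ Finset.range t, ∑ j ∈ Finset.range (roundGroups α β δ u), ω.1 (u, j)

/-- The transcript of round `t`, if it is run: its users are those that follow the users of the
earlier rounds. -/
def roundTranscript {k : ℕ} (α β δ : ℝ) (x : ℕ → Fin k) (ω : Seed (numSalts α β) k) (t : ℕ) :
    RunTranscript (numSalts α β) k :=
  runTranscript (roundGroups α β δ t) (fun j => ω.1 (t, j)) (fun q => ω.2.1 (t, q))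
    (fun i => ω.2.2 (usersBefore α β δ ω t + i)) (fun i => x (usersBefore α β δ ω t + i))

/-- The estimate of the collision probability in round `t`. -/
def roundEstimate {k : ℕ} (α β δ : ℝ) (x : ℕ → Fin k) (ω : Seed (numSalts α β) k) (t : ℕ) : ℝ :=
  estimate (roundSupergroups δ t) (roundGroupsPer α β δ t) (roundRate α β δ t)
    (roundTranscript α β δ x ω t)

/-- The rejection criterion of round `t`. -/
def Exceeds {k : ℕ} (c₀ α β δ : ℝ) (x : ℕ → Fin k) (ω : Seed (numSalts α β) k) (t : ℕ) : Prop :=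
  radius α β δ t < |roundEstimate α β δ x ω t - c₀|

/-- The tester rejects the null hypothesis at the end of round `t`. -/
def RejectsAt {k : ℕ} (c₀ α β δ : ℝ) (x : ℕ → Fin k) (ω : Seed (numSalts α β) k) (t : ℕ) : Prop :=
  Exceeds c₀ α β δ x ω t ∧ ∀ u < t, ¬ Exceeds c₀ α β δ x ω u

/-- The tester rejects the null hypothesis after observing at most `B` samples. -/
def RejectsWithin {k : ℕ} (c₀ α β δ : ℝ) (B : ℝ) (x : ℕ → Fin k) (ω : Seed (numSalts α β) k) :
    Prop :=
  ∃ t, RejectsAt c₀ α β δ x ω t ∧ (usersBefore α β δ ω (t + 1) : ℝ) ≤ B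

open Classical in
/-- The transcript of the tester: the sequence of the transcripts of its rounds, where
`Sum.inl ()` stands for a round that is not run because the tester has stopped before. -/
def transcript {k : ℕ} (c₀ α β δ : ℝ) (x : ℕ → Fin k) (ω : Seed (numSalts α β) k) :
    ℕ → Unit ⊕ RunTranscript (numSalts α β) k :=
  fun t => if ∃ u < t, RejectsAt c₀ α β δ x ω u then Sum.inl ()
    else Sum.inr (roundTranscript α β δ x ω t)

end

end CollisionTest

/-! Privacy. Fix the group sizes and the hash function. The group sizes alone decide where a user
sits, and a user sits in at most one group `(t, j)`. Stopping is a function of what the rounds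
publish, so the transcript depends on the salt and the sample of user `i` only through one published
sign (`transcript_congr`). Call the hash function balanced for a sample `y` if its `r` values at `y`
in group `j` sum to at most `τ r` in absolute value, with `τ = (e^α - 1) / (e^α + 1)`. If it is
balanced for both candidate samples, each sign has probability between `(1 - τ) / 2` and `(1 + τ) /
2`, and the ratio of these bounds is `e^α`. Hoeffding's inequality and the choice of `r` make
imbalance an event of probability at most `β / 2` per sample (`measure_unbalanced_le`), which
accounts for the summand `β`.

Accuracy of one round. Given the hash function, the signs of a group are i.i.d. with mean `Q = ∑
q(z) h(z)`, where `q` is the law of a salted sample. Averaging over `h` gives `E Q² = ∑ q² = C / r`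
and `E Q⁴ ≤ 3 (∑ q²)²`. Poisson group sizes turn falling factorials into powers of `m`, so `E V² = m
+ m² C / r`: the group estimates are unbiased, and their variance is at most `5` because `m ≥ 160 r
/ 21` (`variance_estimate_sumLaw`). Conditionally on the sizes, distinct groups use distinct users
and distinct hash arguments, so the group sums of a round are i.i.d. (`map_roundSums`). Chebyshev
within supergroups and Hoeffding across them give an error above `radius t` with probability at most
`failProb δ t` (`measure_far_le`).

Testing. Under the null hypothesis a union bound over the rounds suffices; independence between
rounds is never needed. Under the alternative, a round `T` with `2 * radius T < ε` exceeds its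
threshold whenever its estimate is accurate. The least `T` guaranteed by the bound `radius t ^ 2 ≤
(1 + t) / 2 ^ t` has `2 ^ T` of order `log (1 / ε) / ε²` (`exists_round`). The actual number of
users is at most four times its mean except with probability `δ / 2`, by Markov's inequality for `2
^ N` (`measure_usersBefore_gt_le`). -/

open MeasureTheory ProbabilityTheory

namespace CollisionTest

open scoped NNReal

/-! ### Infinite product measures: integrals, zipping, resampling a coordinate. -/

section ProductMeasures

/-- The integral of a finite product of functions of distinct coordinates. -/
lemma lintegral_prod_infinitePi {ι : Type*} {X : ι → Type*} {mX : ∀ i, MeasurableSpace (X i)}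
    (μ : ∀ i, Measure (X i)) [∀ i, IsProbabilityMeasure (μ i)] (s : Finset ι)
    (f : ∀ i, X i → ENNReal) (hf : ∀ i, Measurable (f i)) :
    ∫⁻ ω, ∏ i ∈ s, f i (ω i) ∂Measure.infinitePi μ = ∏ i ∈ s, ∫⁻ y, f i y ∂μ i := by
  have h := lintegral_prod_eq_prod_lintegral_of_indepFun s (fun i (ω : ∀ i, X i) => f i (ω i))
    (iIndepFun_infinitePi (P := μ) hf) (fun i => (hf i).comp (measurable_pi_apply i))
  rw [h]
  refine Finset.prod_congr rfl fun i _ => ?_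
  rw [← Measure.infinitePi_map_eval μ i, lintegral_map (hf i) (measurable_pi_apply i)]

/-- The product of two infinite product measures is an infinite product of product measures. -/
lemma infinitePi_prod_map_zip {ι : Type*} {X Y : ι → Type*} {mX : ∀ i, MeasurableSpace (X i)}
    {mY : ∀ i, MeasurableSpace (Y i)} (μ : ∀ i, Measure (X i)) [∀ i, IsProbabilityMeasure (μ i)]
    (ν : ∀ i, Measure (Y i)) [∀ i, IsProbabilityMeasure (ν i)] :
    ((Measure.infinitePi μ).prod (Measure.infinitePi ν)).map
      (fun z i => ((z.1 i, z.2 i) : X i × Y i)) = Measure.infinitePi fun i => (μ i).prod (ν i) := by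
  have hm : Measurable (fun (z : (∀ i, X i) × (∀ i, Y i)) i => ((z.1 i, z.2 i) : X i × Y i)) := by
    fun_prop
  refine Measure.eq_infinitePi _ fun s t ht => ?_
  have hs : MeasurableSet (Set.pi (s : Set ι) t) :=
    .pi s.countable_toSet fun i _ => ht i
  rw [Measure.map_apply hm hs, Measure.prod_apply (hm hs)]
  have : ∀ a : ∀ i, X i, Measure.infinitePi ν (Prod.mk a ⁻¹'
      ((fun (z : (∀ i, X i) × (∀ i, Y i)) i => ((z.1 i, z.2 i) : X i × Y i)) ⁻¹'
        Set.pi (s : Set ι) t)) = ∏ i ∈ s, ν i (Prod.mk (a i) ⁻¹' t i) := by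
    intro a
    rw [← Measure.infinitePi_pi ν (fun i _ => measurable_prodMk_left (ht i))]
    rfl
  simp_rw [this]
  rw [lintegral_prod_infinitePi μ s (fun i a => ν i (Prod.mk a ⁻¹' t i))
    (fun i => measurable_measure_prodMk_left (ht i))]
  exact Finset.prod_congr rfl fun i _ => (Measure.prod_apply (ht i)).symm

/-- Resampling one coordinate does not change an infinite product measure. -/
lemma infinitePi_map_update {ι : Type*} [DecidableEq ι] {X : Type*} [MeasurableSpace X]
    (μ : Measure X) [IsProbabilityMeasure μ] (i : ι) :
    ((Measure.infinitePi fun _ : ι => μ).prod μ).map (fun z => Function.update z.1 i z.2) =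
      Measure.infinitePi fun _ : ι => μ := by
  have hm : Measurable (fun z : (ι → X) × X => Function.update z.1 i z.2) := by
    refine measurable_pi_lambda _ fun j => ?_
    by_cases h : j = i
    · subst h; simpa using measurable_snd
    · simp only [Function.update_of_ne h]; fun_prop
  refine Measure.eq_infinitePi _ fun s t ht => ?_
  have hs : MeasurableSet (Set.pi (s : Set ι) t) := .pi s.countable_toSet fun i _ => ht i
  rw [Measure.map_apply hm hs]
  by_cases hi : i ∈ s
  · have : (fun z : (ι → X) × X => Function.update z.1 i z.2) ⁻¹' Set.pi (s : Set ι) t =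
        Set.pi ((s.erase i : Finset ι) : Set ι) t ×ˢ t i := by
      ext z
      simp only [Set.mem_preimage, Set.mem_pi, Finset.mem_coe, Set.mem_prod, Finset.mem_erase]
      constructor
      · intro h
        refine ⟨fun j hj => ?_, by simpa using h i hi⟩
        simpa [Function.update_of_ne hj.1] using h j hj.2
      · rintro ⟨h1, h2⟩ j hj
        by_cases hji : j = i
        · subst hji; simpa using h2
        · simpa [Function.update_of_ne hji] using h1 j ⟨hji, hj⟩
    rw [this, Measure.prod_prod, Measure.infinitePi_pi _ (fun i _ => ht i), mul_comm,
      Finset.mul_prod_erase s (fun j => μ (t j)) hi]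
  · have : (fun z : (ι → X) × X => Function.update z.1 i z.2) ⁻¹' Set.pi (s : Set ι) t =
        Set.pi (s : Set ι) t ×ˢ Set.univ := by
      ext z
      simp only [Set.mem_preimage, Set.mem_pi, Finset.mem_coe, Set.mem_prod, Set.mem_univ, and_true]
      refine forall₂_congr fun j hj => ?_
      rw [Function.update_of_ne (by rintro rfl; exact hi hj)]
    rw [this, Measure.prod_prod, Measure.infinitePi_pi _ (fun i _ => ht i)]
    simp

/-- The σ-algebra on units is pulled back from `ℤ`, so singletons are measurable. -/
instance : DiscreteMeasurableSpace ℤˣ := by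
  have : MeasurableSingletonClass ℤˣ := ⟨fun a => ⟨{(a : ℤ)}, trivial, by ext; simp [Units.ext_iff]⟩⟩
  infer_instance

end ProductMeasures

/-! ### Moments of sums of two independent bounded variables. -/

section Moments

variable {Ω : Type*} [MeasurableSpace Ω] {μ : Measure Ω}

/-- A bounded measurable function and its powers are integrable. -/
lemma integrable_of_abs_le [IsFiniteMeasure μ] {f : Ω → ℝ} (hf : Measurable f) (C : ℝ)
    (h : ∀ ω, |f ω| ≤ C) : Integrable f μ :=
  Integrable.of_bound hf.aestronglyMeasurable C (ae_of_all _ h)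

lemma integrable_pow_mul_pow [IsFiniteMeasure μ] {A B : Ω → ℝ} (hA : Measurable A)
    (hB : Measurable B) {C D : ℝ} (hC : ∀ ω, |A ω| ≤ C) (hD : ∀ ω, |B ω| ≤ D) (i j : ℕ) :
    Integrable (fun ω => A ω ^ i * B ω ^ j) μ := by
  refine integrable_of_abs_le (by fun_prop) (C ^ i * D ^ j) fun ω => ?_
  rw [abs_mul, abs_pow, abs_pow]
  have := (abs_nonneg (A ω)).trans (hC ω)
  gcongr
  · exact hC ω
  · exact hD ω

lemma integral_pow_mul_pow {A B : Ω → ℝ} (hA : Measurable A)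
    (hB : Measurable B) (hAB : IndepFun A B μ) (i j : ℕ) :
    ∫ ω, A ω ^ i * B ω ^ j ∂μ = (∫ ω, A ω ^ i ∂μ) * ∫ ω, B ω ^ j ∂μ :=
  IndepFun.integral_fun_mul_eq_mul_integral
    (hAB.comp (φ := fun x => x ^ i) (ψ := fun x => x ^ j) (by fun_prop) (by fun_prop))
    (by fun_prop) (by fun_prop)

/-- Moments of the sum of two independent bounded variables. -/
lemma integral_add_pow_of_indepFun [IsFiniteMeasure μ] {A B : Ω → ℝ} (hA : Measurable A)
    (hB : Measurable B) {C D : ℝ} (hC : ∀ ω, |A ω| ≤ C) (hD : ∀ ω, |B ω| ≤ D)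
    (hAB : IndepFun A B μ) (n : ℕ) :
    ∫ ω, (A ω + B ω) ^ n ∂μ = ∑ i ∈ Finset.range (n + 1),
      (n.choose i : ℝ) * ((∫ ω, A ω ^ i ∂μ) * ∫ ω, B ω ^ (n - i) ∂μ) := by
  simp_rw [add_pow]
  rw [integral_finsetSum]
  · refine Finset.sum_congr rfl fun i _ => ?_
    rw [integral_mul_const, integral_pow_mul_pow hA hB hAB, mul_comm]
  · exact fun i _ => (integrable_pow_mul_pow hA hB hC hD _ _).mul_const _

end Moments

/-! ### Moments of sums of independent signs, biased or weighted. -/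

section SumsOfSigns

variable {Ω : Type*} [MeasurableSpace Ω] {μ : Measure Ω} [IsProbabilityMeasure μ]

/-- The first four moments of a sum of independent signs with mean `Q`. -/
lemma moments_sum_signs {X : ℕ → Ω → ℝ} (hX : ∀ i, Measurable (X i)) (hind : iIndepFun X μ)
    (hsq : ∀ i ω, X i ω ^ 2 = 1) {Q : ℝ} (hQ : ∀ i, ∫ ω, X i ω ∂μ = Q) (n : ℕ) :
    ∫ ω, (∑ i ∈ Finset.range n, X i ω) ∂μ = n * Q ∧
    ∫ ω, (∑ i ∈ Finset.range n, X i ω) ^ 2 ∂μ = n + n * (n - 1) * Q ^ 2 ∧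
    ∫ ω, (∑ i ∈ Finset.range n, X i ω) ^ 3 ∂μ =
      n * (n - 1) * (n - 2) * Q ^ 3 + 3 * (n * (n - 1)) * Q + n * Q ∧
    ∫ ω, (∑ i ∈ Finset.range n, X i ω) ^ 4 ∂μ =
      n * (n - 1) * (n - 2) * (n - 3) * Q ^ 4 + 6 * (n * (n - 1) * (n - 2)) * Q ^ 2
        + (3 + 4 * Q ^ 2) * (n * (n - 1)) + n := by
  have habs : ∀ i ω, |X i ω| ≤ 1 := fun i ω => by
    have := hsq i ω
    exact abs_le_one_iff_mul_self_le_one.2 (by nlinarith)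
  have h2 : ∀ i, ∫ ω, X i ω ^ 2 ∂μ = 1 := fun i => by simp [hsq]
  have h3 : ∀ i, ∫ ω, X i ω ^ 3 ∂μ = Q := fun i => by
    rw [← hQ i]; congr 1; ext ω; rw [pow_succ, hsq, one_mul]
  have h4 : ∀ i, ∫ ω, X i ω ^ 4 ∂μ = 1 := fun i => by
    have : ∀ ω, X i ω ^ 4 = 1 := fun ω => by
      rw [show X i ω ^ 4 = (X i ω ^ 2) ^ 2 by ring, hsq, one_pow]
    simp [this]
  have hbd : ∀ n ω, |∑ i ∈ Finset.range n, X i ω| ≤ n := fun n ω => by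
    refine (Finset.abs_sum_le_sum_abs _ _).trans ?_
    simpa using Finset.sum_le_sum fun i (_ : i ∈ Finset.range n) => habs i ω
  induction n with
  | zero => simp
  | succ n ih =>
    obtain ⟨i1, i2, i3, i4⟩ := ih
    have hI : IndepFun (fun ω => ∑ i ∈ Finset.range n, X i ω) (X n) μ := by
      have := hind.indepFun_sum_range_succ hX n
      convert this using 2
      simp
    have key := integral_add_pow_of_indepFun (μ := μ)
      (Finset.measurable_fun_sum (Finset.range n) fun i _ => hX i) (hX n) (hbd n) (habs n) hI
    simp_rw [Finset.sum_range_succ _ n]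
    have k1 := key 1
    have k2 := key 2
    have k3 := key 3
    have k4 := key 4
    simp only [Finset.sum_range_succ, Finset.range_zero, Finset.sum_empty] at k1 k2 k3 k4
    norm_num [Nat.choose] at k1 k2 k3 k4
    refine ⟨?_, ?_, ?_, ?_⟩
    · rw [k1, i1, hQ]; push_cast; ring
    · rw [k2, i1, i2, hQ, h2]; push_cast; ring
    · rw [k3, i1, i2, i3, hQ, h2, h3]; push_cast; ring
    · rw [k4, i1, i2, i3, i4, hQ, h2, h3, h4]; push_cast; ring

/-- The first four moments of a weighted sum of independent uniform signs. -/
lemma moments_sum_symmetric {ι : Type*} {X : ι → Ω → ℝ} (hX : ∀ i, Measurable (X i))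
    (hind : iIndepFun X μ) {q : ι → ℝ} (hsq : ∀ i ω, X i ω ^ 2 = q i ^ 2)
    (hQ : ∀ i, ∫ ω, X i ω ∂μ = 0) (s : Finset ι) :
    ∫ ω, (∑ i ∈ s, X i ω) ∂μ = 0 ∧
    ∫ ω, (∑ i ∈ s, X i ω) ^ 2 ∂μ = ∑ i ∈ s, q i ^ 2 ∧
    ∫ ω, (∑ i ∈ s, X i ω) ^ 3 ∂μ = 0 ∧
    ∫ ω, (∑ i ∈ s, X i ω) ^ 4 ∂μ ≤ 3 * (∑ i ∈ s, q i ^ 2) ^ 2 := by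
  classical
  have habs : ∀ i ω, |X i ω| ≤ |q i| := fun i ω => (sq_eq_sq_iff_abs_eq_abs _ _).1 (hsq i ω) |>.le
  have h2 : ∀ i, ∫ ω, X i ω ^ 2 ∂μ = q i ^ 2 := fun i => by simp [hsq]
  have h3 : ∀ i, ∫ ω, X i ω ^ 3 ∂μ = 0 := fun i => by
    simp_rw [pow_succ _ 2, hsq, integral_const_mul, hQ, mul_zero]
  have h4 : ∀ i, ∫ ω, X i ω ^ 4 ∂μ = q i ^ 4 := fun i => by
    have : ∀ ω, X i ω ^ 4 = q i ^ 4 := fun ω => by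
      rw [show X i ω ^ 4 = (X i ω ^ 2) ^ 2 by ring, hsq]; ring
    simp [this]
  have hbd : ∀ (s : Finset ι) ω, |∑ i ∈ s, X i ω| ≤ ∑ i ∈ s, |q i| := fun s ω =>
    (Finset.abs_sum_le_sum_abs _ _).trans (Finset.sum_le_sum fun i _ => habs i ω)
  induction s using Finset.induction_on with
  | empty => simp
  | insert a s ha ih =>
    obtain ⟨i1, i2, i3, i4⟩ := ih
    have hI : IndepFun (fun ω => ∑ i ∈ s, X i ω) (X a) μ := by
      have := hind.indepFun_finsetSum_of_notMem hX ha
      convert this using 2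
      simp
    have key := integral_add_pow_of_indepFun (μ := μ)
      (Finset.measurable_fun_sum s fun i _ => hX i) (hX a) (hbd s) (habs a) hI
    simp_rw [Finset.sum_insert ha, add_comm (X a _)]
    have k1 := key 1
    have k2 := key 2
    have k3 := key 3
    have k4 := key 4
    simp only [Finset.sum_range_succ, Finset.range_zero, Finset.sum_empty] at k1 k2 k3 k4
    norm_num [Nat.choose] at k1 k2 k3 k4
    refine ⟨?_, ?_, ?_, ?_⟩
    · rw [k1, i1, hQ]; ring
    · rw [k2, i1, i2, hQ, h2]; ring
    · rw [k3, i1, i2, i3, hQ, h2, h3]; ring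
    · rw [k4, i1, i2, i3, hQ, h2, h3, h4]
      nlinarith [sq_nonneg (q a ^ 2), sq_nonneg (q a)]

end SumsOfSigns

/-! ### Factorial moments of the Poisson distribution. -/

section Poisson

open scoped Nat

/-- The factorial moments of the Poisson distribution. -/
lemma hasSum_descFactorial_poisson (m : ℝ≥0) (k : ℕ) :
    HasSum (fun n : ℕ => (Real.exp (-m) * m ^ n / n !) * (n.descFactorial k : ℝ)) ((m : ℝ) ^ k) := by
  rw [← hasSum_nat_add_iff' k]
  have h0 : ∑ i ∈ Finset.range k,
      (Real.exp (-m) * m ^ i / i !) * (i.descFactorial k : ℝ) = 0 := by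
    refine Finset.sum_eq_zero fun i hi => ?_
    rw [Nat.descFactorial_of_lt (Finset.mem_range.1 hi)]; simp
  rw [h0, sub_zero]
  have := (hasSum_one_poissonMeasure m).mul_left ((m : ℝ) ^ k)
  rw [mul_one] at this
  refine this.congr_fun ?_
  intro n
  have h1 : ((n + k)! : ℝ) = n ! * ((n + k).descFactorial k : ℝ) := by
    have := Nat.factorial_mul_descFactorial (Nat.le_add_left k n)
    rw [Nat.add_sub_cancel] at this
    exact_mod_cast this.symm
  have h2 : ((n + k).descFactorial k : ℝ) ≠ 0 := by
    have := Nat.pos_of_ne_zero (fun h => (Nat.descFactorial_eq_zero_iff_lt.1 h).not_ge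
      (Nat.le_add_left k n))
    positivity
  have h3 : (n ! : ℝ) ≠ 0 := by positivity
  rw [h1, pow_add]
  field_simp

lemma integrable_descFactorial_poisson (m : ℝ≥0) (k : ℕ) :
    Integrable (fun n : ℕ => (n.descFactorial k : ℝ)) (poissonMeasure m) := by
  rw [integrable_poissonMeasure_iff]
  simpa using (hasSum_descFactorial_poisson m k).summable

lemma integral_descFactorial_poisson (m : ℝ≥0) (k : ℕ) :
    ∫ n : ℕ, (n.descFactorial k : ℝ) ∂poissonMeasure m = (m : ℝ) ^ k := by
  rw [integral_poissonMeasure]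
  exact (hasSum_descFactorial_poisson m k).tsum_eq

lemma cast_descFactorial_two_eq (n : ℕ) : (n.descFactorial 2 : ℝ) = n * (n - 1) := by
  rcases n with _ | n <;> simp [Nat.descFactorial, mul_comm]

lemma cast_descFactorial_three (n : ℕ) :
    (n.descFactorial 3 : ℝ) = n * (n - 1) * (n - 2) := by
  rcases n with _ | _ | n <;> simp [Nat.descFactorial]; ring

lemma cast_descFactorial_four (n : ℕ) :
    (n.descFactorial 4 : ℝ) = n * (n - 1) * (n - 2) * (n - 3) := by
  rcases n with _ | _ | _ | n <;> simp [Nat.descFactorial]; ring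

lemma integrable_pow_four_poisson (m : ℝ≥0) :
    Integrable (fun n : ℕ => (n : ℝ) ^ 4) (poissonMeasure m) := by
  -- The coefficients 1, 6, 7, 1 are the Stirling numbers that expand `n ^ 4` in falling factorials.
  have h := (((integrable_descFactorial_poisson m 4).add
    ((integrable_descFactorial_poisson m 3).const_mul 6)).add
    ((integrable_descFactorial_poisson m 2).const_mul 7)).add (integrable_descFactorial_poisson m 1)
  refine h.congr (ae_of_all _ fun n => ?_)
  simp only [Pi.add_apply, cast_descFactorial_two_eq, cast_descFactorial_three,
    cast_descFactorial_four, Nat.descFactorial_one]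
  ring

end Poisson

/-! ### The uniform sign. -/

section UniformSign

lemma uniformOn_sign_singleton (u : ℤˣ) : (uniformOn (Set.univ : Set ℤˣ)).real {u} = 1 / 2 := by
  rw [Measure.real, uniformOn_univ]
  simp

lemma integral_uniformOn_sign (f : ℤˣ → ℝ) :
    ∫ u, f u ∂uniformOn (Set.univ : Set ℤˣ) = (f 1 + f (-1)) / 2 := by
  rw [integral_fintype .of_finite]
  simp only [uniformOn_sign_singleton]
  rw [show (Finset.univ : Finset ℤˣ) = {1, -1} from rfl, Finset.sum_pair (by decide)]
  simp only [smul_eq_mul]; ring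

lemma sign_sq (u : ℤˣ) : ((u : ℤ) : ℝ) ^ 2 = 1 := by
  rcases Int.units_eq_one_or u with rfl | rfl <;> simp

end UniformSign

/-! ### A single group: moments of its sum of hash values. -/

section GroupModel

set_option linter.unusedSectionVars false

variable {Z : Type*} [Fintype Z] [MeasurableSpace Z] [MeasurableSingletonClass Z]

/-- The law of uniformly random independent signs. -/
noncomputable def signLaw (Z : Type*) : Measure (Z → ℤˣ) :=
  Measure.infinitePi fun _ => uniformOn (Set.univ : Set ℤˣ)

instance (Z : Type*) : IsProbabilityMeasure (signLaw Z) := by unfold signLaw; infer_instance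

/-- The sum of the hash values of the first `n` users of a group with hash function `z.1`, where
the user `i` has the salted sample `z.2 i`. -/
def signSum (n : ℕ) (z : (Z → ℤˣ) × (ℕ → Z)) : ℤ := ∑ i ∈ Finset.range n, (z.1 (z.2 i) : ℤ)

/-- The law of a hash function and of independent salted samples with law `q`. -/
noncomputable def userLaw (q : Measure Z) [IsProbabilityMeasure q] :
    Measure ((Z → ℤˣ) × (ℕ → Z)) :=
  (signLaw Z).prod (Measure.infinitePi fun _ : ℕ => q)

instance (q : Measure Z) [IsProbabilityMeasure q] : IsProbabilityMeasure (userLaw q) := by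
  unfold userLaw; infer_instance

/-- The law of the size, the hash function and the salted samples of a group. -/
noncomputable def groupLaw (m : ℝ≥0) (q : Measure Z) [IsProbabilityMeasure q] :
    Measure (ℕ × (Z → ℤˣ) × (ℕ → Z)) :=
  (poissonMeasure m).prod (userLaw q)

instance (m : ℝ≥0) (q : Measure Z) [IsProbabilityMeasure q] :
    IsProbabilityMeasure (groupLaw m q) := by unfold groupLaw; infer_instance

lemma measurable_apply_index {ι X : Type*} [Countable ι] [MeasurableSpace ι]
    [MeasurableSingletonClass ι] [MeasurableSpace X] :
    Measurable fun p : (ι → X) × ι => p.1 p.2 :=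
  measurable_from_prod_countable_left fun i => measurable_pi_apply i

lemma measurable_signSum (n : ℕ) : Measurable (signSum n : (Z → ℤˣ) × (ℕ → Z) → ℤ) := by
  unfold signSum
  refine Finset.measurable_fun_sum _ fun i _ => ?_
  have hp : Measurable fun z : (Z → ℤˣ) × (ℕ → Z) => (z.1, z.2 i) := by fun_prop
  have h : Measurable fun z : (Z → ℤˣ) × (ℕ → Z) => z.1 (z.2 i) := measurable_apply_index.comp hp
  exact (Measurable.of_discrete (f := fun u : ℤˣ => (u : ℤ))).comp h

lemma measurable_signSum_uncurry :
    Measurable (fun z : ℕ × (Z → ℤˣ) × (ℕ → Z) => signSum z.1 z.2) :=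
  measurable_from_prod_countable_right fun n => measurable_signSum n

lemma abs_signSum_le (n : ℕ) (z : (Z → ℤˣ) × (ℕ → Z)) : |(signSum n z : ℝ)| ≤ n := by
  unfold signSum
  push_cast
  refine (Finset.abs_sum_le_sum_abs _ _).trans ?_
  simpa using Finset.sum_le_sum fun i (_ : i ∈ Finset.range n) =>
    (abs_le_one_iff_mul_self_le_one.2 (by rw [← sq, sign_sq]) : |(((z.1 (z.2 i)) : ℤ) : ℝ)| ≤ 1)

variable (q : Measure Z) [IsProbabilityMeasure q]

/-- The mean hash value of a user, for a given hash function. -/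
noncomputable def meanSign (c : Z → ℤˣ) : ℝ := ∑ z, q.real {z} * ((c z : ℤ) : ℝ)

/-- For a fixed hash function the users' signs are i.i.d. The falling factorials are kept because
their Poisson means are pure powers of `m`. -/
lemma moments_signSum_cond (c : Z → ℤˣ) (n : ℕ) :
    ∫ y, (signSum n (c, y) : ℝ) ^ 2 ∂Measure.infinitePi (fun _ : ℕ => q) =
      n + n * (n - 1) * meanSign q c ^ 2 ∧
    ∫ y, (signSum n (c, y) : ℝ) ^ 4 ∂Measure.infinitePi (fun _ : ℕ => q) =
      n * (n - 1) * (n - 2) * (n - 3) * meanSign q c ^ 4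
        + 6 * (n * (n - 1) * (n - 2)) * meanSign q c ^ 2
        + (3 + 4 * meanSign q c ^ 2) * (n * (n - 1)) + n := by
  have hm : Measurable fun z : Z => ((c z : ℤ) : ℝ) := .of_discrete
  have h := moments_sum_signs (μ := Measure.infinitePi (fun _ : ℕ => q))
    (X := fun i y => ((c (y i) : ℤ) : ℝ)) (fun i => hm.comp (measurable_pi_apply i))
    (iIndepFun_infinitePi (P := fun _ : ℕ => q) (X := fun _ z => ((c z : ℤ) : ℝ)) fun _ => hm)
    (fun i y => sign_sq _) (Q := meanSign q c) (fun i => by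
      have := (integral_map (μ := Measure.infinitePi (fun _ : ℕ => q))
        (measurable_pi_apply i).aemeasurable (f := fun z => ((c z : ℤ) : ℝ))
        hm.aestronglyMeasurable)
      rw [← this, Measure.infinitePi_map_eval, integral_fintype .of_finite]
      simp [meanSign]) n
  simp only [signSum, Int.cast_sum]
  exact ⟨h.2.1, h.2.2.2⟩

/-- Over a random hash function, `meanSign` is a Rademacher sum with weights `q {z}`: the cross
terms vanish, and the fourth moment obeys Khinchine's bound with constant 3. -/
lemma moments_meanSign :
    ∫ c, meanSign q c ^ 2 ∂signLaw Z = ∑ z, q.real {z} ^ 2 ∧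
    ∫ c, meanSign q c ^ 4 ∂signLaw Z ≤ 3 * (∑ z, q.real {z} ^ 2) ^ 2 := by
  have hm : ∀ z, Measurable fun u : ℤˣ => q.real {z} * ((u : ℤ) : ℝ) := fun _ => .of_discrete
  have h := moments_sum_symmetric (μ := signLaw Z) (q := fun z => q.real {z})
    (X := fun z c => q.real {z} * ((c z : ℤ) : ℝ)) (fun z => (hm z).comp (measurable_pi_apply z))
    (iIndepFun_infinitePi (P := fun _ : Z => uniformOn (Set.univ : Set ℤˣ))
      (X := fun z u => q.real {z} * ((u : ℤ) : ℝ)) hm)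
    (fun z c => by rw [mul_pow, sign_sq, mul_one]) (fun z => by
      have := (integral_map (μ := signLaw Z)
        (measurable_pi_apply z).aemeasurable (f := fun u => q.real {z} * ((u : ℤ) : ℝ))
        (hm z).aestronglyMeasurable)
      rw [← this, signLaw, Measure.infinitePi_map_eval, integral_uniformOn_sign]
      simp) Finset.univ
  exact ⟨h.2.1, h.2.2.2⟩

lemma measurable_meanSign : Measurable (meanSign q) := by
  unfold meanSign
  refine Finset.measurable_fun_sum _ fun z _ => ?_
  exact (Measurable.of_discrete (f := fun u : ℤˣ => q.real {z} * ((u : ℤ) : ℝ))).comp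
    (measurable_pi_apply z)

lemma abs_meanSign_le (c : Z → ℤˣ) : |meanSign q c| ≤ 1 := by
  unfold meanSign
  refine (Finset.abs_sum_le_sum_abs _ _).trans ?_
  have h1 : ∑ z, q.real {z} = 1 := by
    rw [sum_measureReal_singleton]; simp
  rw [← h1]
  refine Finset.sum_le_sum fun z _ => ?_
  rw [abs_mul, abs_of_nonneg measureReal_nonneg]
  exact mul_le_of_le_one_right measureReal_nonneg
    (abs_le_one_iff_mul_self_le_one.2 (by rw [← sq, sign_sq]))

lemma integrable_meanSign_pow (k : ℕ) : Integrable (fun c => meanSign q c ^ k) (signLaw Z) :=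
  integrable_of_abs_le ((measurable_meanSign q).pow_const k) 1 fun c => by
    rw [abs_pow]; exact pow_le_one₀ (abs_nonneg _) (abs_meanSign_le q c)

lemma integrable_signSum_pow_cond (n k : ℕ) :
    Integrable (fun z => (signSum n z : ℝ) ^ k) (userLaw q) :=
  integrable_of_abs_le ((measurable_from_top.comp (measurable_signSum n)).pow_const k) (n ^ k)
    fun c => by rw [abs_pow]; gcongr; exact abs_signSum_le n c

lemma moments_signSum (n : ℕ) :
    ∫ z, (signSum n z : ℝ) ^ 2 ∂userLaw q =
      n + n * (n - 1) * ∑ z, q.real {z} ^ 2 ∧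
    ∫ z, (signSum n z : ℝ) ^ 4 ∂userLaw q ≤
      n * (n - 1) * (n - 2) * (n - 3) * (3 * (∑ z, q.real {z} ^ 2) ^ 2)
        + 6 * (n * (n - 1) * (n - 2)) * (∑ z, q.real {z} ^ 2)
        + (3 + 4 * ∑ z, q.real {z} ^ 2) * (n * (n - 1)) + n := by
  have i2 := integrable_meanSign_pow q 2
  have i4 := integrable_meanSign_pow q 4
  obtain ⟨m2, m4⟩ := moments_meanSign q
  constructor
  · rw [userLaw, integral_prod _ (integrable_signSum_pow_cond q n 2)]
    simp_rw [(moments_signSum_cond q _ n).1]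
    rw [integral_add (integrable_const _) (i2.const_mul _), integral_const_mul, m2]
    simp
  · rw [userLaw, integral_prod _ (integrable_signSum_pow_cond q n 4)]
    simp_rw [(moments_signSum_cond q _ n).2]
    rw [integral_add _ (integrable_const _), integral_add _ _, integral_add _ _,
      integral_const_mul, integral_const_mul, integral_mul_const, integral_add (integrable_const _),
      integral_const_mul, m2]
    -- Nonnegative also for `n < 4`, being a falling factorial of a natural number.
    · have h4 : (0 : ℝ) ≤ n * (n - 1) * (n - 2) * (n - 3) := by
        rw [← cast_descFactorial_four]; positivity
      have := mul_le_mul_of_nonneg_left m4 h4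
      simp only [integral_const, probReal_univ, one_smul]
      linarith
    · exact i2.const_mul _
    · exact i4.const_mul _
    · exact i2.const_mul _
    · exact (i4.const_mul _).add (i2.const_mul _)
    · exact ((integrable_const _).add (i2.const_mul _)).mul_const _
    · exact ((i4.const_mul _).add (i2.const_mul _)).add
        (((integrable_const _).add (i2.const_mul _)).mul_const _)

variable (m : ℝ≥0)

lemma integrable_groupSum_pow_four :
    Integrable (fun z : ℕ × (Z → ℤˣ) × (ℕ → Z) => (signSum z.1 z.2 : ℝ) ^ 4) (groupLaw m q) := by
  have h : Integrable (fun z : ℕ × (Z → ℤˣ) × (ℕ → Z) => (z.1 : ℝ) ^ 4) (groupLaw m q) :=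
    (integrable_pow_four_poisson m).comp_fst (userLaw q)
  refine h.mono' ?_ (ae_of_all _ fun z => ?_)
  · exact ((measurable_from_top.comp measurable_signSum_uncurry).pow_const 4).aestronglyMeasurable
  · rw [norm_pow]; gcongr; exact abs_signSum_le _ _

lemma memLp_groupSum_sq :
    MemLp (fun z : ℕ × (Z → ℤˣ) × (ℕ → Z) => (signSum z.1 z.2 : ℝ) ^ 2) 2 (groupLaw m q) := by
  rw [memLp_two_iff_integrable_sq]
  · refine (integrable_groupSum_pow_four q m).congr (ae_of_all _ fun z => ?_)
    simp only; ring
  · exact ((measurable_from_top.comp measurable_signSum_uncurry).pow_const 2).aestronglyMeasurable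

/-- Averages `moments_signSum` over the Poisson size. The term `m` of the second moment is the
contribution of each user paired with itself, which the estimate subtracts. -/
lemma moments_groupSum :
    ∫ z, (signSum z.1 z.2 : ℝ) ^ 2 ∂groupLaw m q = m + m ^ 2 * ∑ z, q.real {z} ^ 2 ∧
    ∫ z, (signSum z.1 z.2 : ℝ) ^ 4 ∂groupLaw m q ≤
      m ^ 4 * (3 * (∑ z, q.real {z} ^ 2) ^ 2) + 6 * m ^ 3 * (∑ z, q.real {z} ^ 2)
        + (3 + 4 * ∑ z, q.real {z} ^ 2) * m ^ 2 + m := by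
  have d := integrable_descFactorial_poisson m
  have e := integral_descFactorial_poisson m
  constructor
  · rw [groupLaw, integral_prod _ ((memLp_groupSum_sq q m).integrable (by norm_num))]
    simp_rw [(moments_signSum q _).1, ← cast_descFactorial_two_eq]
    have d1 := d 1
    have e1 := e 1
    simp only [Nat.descFactorial_one, pow_one] at d1 e1
    rw [integral_add d1 ((d 2).mul_const _), integral_mul_const, e1, e]
  · rw [groupLaw, integral_prod _ (integrable_groupSum_pow_four q m)]
    have d1 := d 1
    have e1 := e 1
    simp only [Nat.descFactorial_one, pow_one] at d1 e1
    set S := ∑ z, q.real {z} ^ 2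
    have i1 : Integrable (fun n : ℕ => (n.descFactorial 4 : ℝ) * (3 * S ^ 2)
        + 6 * (n.descFactorial 3 : ℝ) * S + (3 + 4 * S) * (n.descFactorial 2 : ℝ))
        (poissonMeasure m) := (((d 4).mul_const (3 * S ^ 2)).add (((d 3).const_mul 6).mul_const S)).add
      ((d 2).const_mul (3 + 4 * S))
    calc _ ≤ ∫ n : ℕ, ((n.descFactorial 4 : ℝ) * (3 * S ^ 2) + 6 * (n.descFactorial 3 : ℝ) * S
          + (3 + 4 * S) * (n.descFactorial 2 : ℝ) + n) ∂poissonMeasure m := by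
          refine integral_mono (integrable_groupSum_pow_four q m).integral_prod_left
            (i1.add d1) fun n => ?_
          simp only [cast_descFactorial_two_eq, cast_descFactorial_three, cast_descFactorial_four]
          exact (moments_signSum q n).2
      _ = _ := by
          rw [integral_add i1 d1, integral_add _ ((d 2).const_mul _),
            integral_add ((d 4).mul_const _) (((d 3).const_mul 6).mul_const S), integral_mul_const,
            integral_mul_const, integral_const_mul, integral_const_mul, e, e, e, e1]
          exact ((d 4).mul_const (3 * S ^ 2)).add (((d 3).const_mul 6).mul_const S)

end GroupModel

/-! ### Mean and variance of the estimate of one group. -/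

section Variance

variable {Z : Type*} [Fintype Z] [MeasurableSpace Z] [MeasurableSingletonClass Z]
  (q : Measure Z) [IsProbabilityMeasure q] (m : ℝ≥0)

/-- The law of the sum of the hash values of a group. -/
noncomputable def sumLaw : Measure ℤ := (groupLaw m q).map fun z => signSum z.1 z.2

instance : IsProbabilityMeasure (sumLaw q m) :=
  Measure.isProbabilityMeasure_map measurable_signSum_uncurry.aemeasurable

lemma integral_sumLaw (f : ℤ → ℝ) :
    ∫ v, f v ∂sumLaw q m = ∫ z, f (signSum z.1 z.2) ∂groupLaw m q :=
  integral_map measurable_signSum_uncurry.aemeasurable measurable_from_top.aestronglyMeasurable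

lemma memLp_sq_sumLaw : MemLp (fun v : ℤ => (v : ℝ) ^ 2) 2 (sumLaw q m) := by
  rw [sumLaw, memLp_map_measure_iff measurable_from_top.aestronglyMeasurable
    measurable_signSum_uncurry.aemeasurable]
  exact memLp_groupSum_sq q m

lemma memLp_estimate_sumLaw (r : ℕ) :
    MemLp (fun v : ℤ => r * ((v : ℝ) ^ 2 - m) / (m : ℝ) ^ 2) 2 (sumLaw q m) := by
  have := ((memLp_sq_sumLaw q m).sub (memLp_const (m : ℝ))).const_mul (r / (m : ℝ) ^ 2)
  refine this.ae_eq (ae_of_all _ fun v => ?_)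
  simp only [Pi.sub_apply]; ring

/-- The estimate of a group is unbiased. -/
lemma integral_estimate_sumLaw (r : ℕ) (hm : 0 < m) :
    ∫ v : ℤ, r * ((v : ℝ) ^ 2 - m) / (m : ℝ) ^ 2 ∂sumLaw q m = r * ∑ z, q.real {z} ^ 2 := by
  have h := (memLp_sq_sumLaw q m).integrable (by norm_num)
  rw [integral_div, integral_const_mul, integral_sub h (integrable_const _), integral_sumLaw,
    (moments_groupSum q m).1]
  have : (m : ℝ) ≠ 0 := by exact_mod_cast hm.ne'
  simp only [integral_const, probReal_univ, smul_eq_mul]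
  field_simp
  ring

/-- The estimate of a group has variance at most `5` if the group is large enough. -/
lemma variance_estimate_sumLaw (r : ℕ) (hr : 1 ≤ r) (hm : 160 * (r : ℝ) ≤ 21 * m)
    (hS : r * ∑ z, q.real {z} ^ 2 ≤ 1) :
    variance (fun v : ℤ => r * ((v : ℝ) ^ 2 - m) / (m : ℝ) ^ 2) (sumLaw q m) ≤ 5 := by
  have hr' : (1 : ℝ) ≤ r := by exact_mod_cast hr
  have hm0 : (0 : ℝ) < m := by linarith
  set S := ∑ z, q.real {z} ^ 2 with hSdef
  have hS0 : 0 ≤ S := Finset.sum_nonneg fun _ _ => sq_nonneg _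
  have e1 : (fun v : ℤ => r * ((v : ℝ) ^ 2 - m) / (m : ℝ) ^ 2) =
      fun v : ℤ => (r / (m : ℝ) ^ 2) * ((v : ℝ) ^ 2 - m) := by ext v; ring
  rw [e1, variance_const_mul, variance_sub_const measurable_from_top.aestronglyMeasurable,
    variance_eq_sub (memLp_sq_sumLaw q m)]
  have e2 : ∫ v : ℤ, ((fun v : ℤ => (v : ℝ) ^ 2) ^ 2) v ∂sumLaw q m ≤
      m ^ 4 * (3 * S ^ 2) + 6 * m ^ 3 * S + (3 + 4 * S) * m ^ 2 + m := by
    rw [integral_sumLaw]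
    refine le_trans (le_of_eq ?_) (moments_groupSum q m).2
    congr 1; ext z; simp only [Pi.pow_apply]; ring
  have e3 : ∫ v : ℤ, (v : ℝ) ^ 2 ∂sumLaw q m = m + m ^ 2 * S := by
    rw [integral_sumLaw, (moments_groupSum q m).1]
  rw [e3]
  -- In the variables `C ≤ 1`, `ρ = r / m` and `τ = 1 / m` the variance bound is a polynomial with
  -- nonnegative coefficients, so it can be evaluated at the upper bounds of the variables.
  set C := (r : ℝ) * S with hC
  set ρ := (r : ℝ) / m with hρ
  set τ := 1 / (m : ℝ) with hτ
  have hρ0 : 0 ≤ ρ := by positivity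
  have hτ0 : 0 ≤ τ := by positivity
  have hC0 : 0 ≤ C := by positivity
  have hρ1 : ρ ≤ 21 / 160 := by rw [hρ, div_le_iff₀ hm0]; linarith
  have hτ1 : τ ≤ 21 / 160 := by rw [hτ, div_le_iff₀ hm0]; linarith
  calc _ ≤ (r / (m : ℝ) ^ 2) ^ 2 * (m ^ 4 * (3 * S ^ 2) + 6 * m ^ 3 * S
        + (3 + 4 * S) * m ^ 2 + m - (m + m ^ 2 * S) ^ 2) := by gcongr
    _ = 2 * C ^ 2 + 4 * C * ρ + 2 * ρ ^ 2 + 4 * C * (ρ * τ) + ρ ^ 2 * τ := by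
        rw [hC, hρ, hτ]; field_simp; ring
    _ ≤ 2 * 1 ^ 2 + 4 * 1 * (21 / 160) + 2 * (21 / 160) ^ 2 + 4 * 1 * ((21 / 160) * (21 / 160))
        + (21 / 160) ^ 2 * (21 / 160) := by gcongr
    _ ≤ 5 := by norm_num

end Variance

/-! ### Deterministic properties of the median. -/

section Median

lemma countP_map_range (a : ℕ) (f : ℕ → ℝ) (P : ℝ → Prop) [DecidablePred P] :
    (((List.range a).map f).insertionSort (· ≤ ·)).countP (fun x => decide (P x)) =
      ((Finset.range a).filter fun l => P (f l)).card := by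
  rw [(List.perm_insertionSort _ _).countP_eq, List.countP_map, List.countP_eq_length_filter,
    Finset.card_def, Finset.filter_val, Finset.range_val, Multiset.range, Multiset.filter_coe,
    Multiset.coe_card]
  rfl

lemma median_congr {a : ℕ} {f g : ℕ → ℝ} (h : ∀ l < a, f l = g l) : median a f = median a g := by
  have : (List.range a).map f = (List.range a).map g :=
    List.map_congr_left fun l hl => h l (List.mem_range.1 hl)
  simp only [median, this]

/-- If the median is far from `c`, then so are at least half of the values. -/
lemma le_two_mul_card_of_lt_abs_median (a : ℕ) (f : ℕ → ℝ) (c w : ℝ)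
    (h : w < |median a f - c|) (ha : 0 < a) :
    a ≤ 2 * ((Finset.range a).filter fun l => w < |f l - c|).card := by
  classical
  set L := ((List.range a).map f).insertionSort (· ≤ ·) with hL
  have hlen : L.length = a := by simp [hL]
  have hsort : L.Pairwise (· ≤ ·) := List.pairwise_insertionSort _ _
  have hmono : ∀ i j, i ≤ j → (hj : j < a) → L.getD i 0 ≤ L.getD j 0 := by
    intro i j hij hj
    rw [List.getD_eq_getElem _ _ (by omega), List.getD_eq_getElem _ _ (by omega)]
    rcases hij.eq_or_lt with rfl | hlt
    · exact le_rfl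
    · exact List.pairwise_iff_getElem.1 hsort _ _ _ _ hlt
  have hmed : median a f = (L.getD ((a - 1) / 2) 0 + L.getD (a / 2) 0) / 2 := rfl
  have hle := hmono ((a - 1) / 2) (a / 2) (by omega) (by omega)
  have hcount := countP_map_range a f (fun x => w < |x - c|)
  rw [← hcount, ← hL]
  -- If the median is above `c + w`, so is the upper middle entry, hence all entries from index `a /
  -- 2` on; if it is below `c - w`, so are all entries up to index `(a - 1) / 2`. Either way these
  -- are at least half of the list.
  rcases lt_abs.1 h with h1 | h1
  · have h2 : c + w < L.getD (a / 2) 0 := by rw [hmed] at h1; linarith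
    have h3 : (L.drop (a / 2)).countP (fun x => decide (w < |x - c|)) = (L.drop (a / 2)).length := by
      rw [List.countP_eq_length]
      intro x hx
      obtain ⟨n, hn, rfl⟩ := List.mem_iff_getElem.1 hx
      rw [List.length_drop] at hn
      rw [List.getElem_drop]
      have := hmono (a / 2) (a / 2 + n) (by omega) (by omega)
      rw [List.getD_eq_getElem (n := a / 2 + n) _ _ (by omega)] at this
      exact decide_eq_true (lt_abs.2 (Or.inl (by linarith)))
    have h4 := (List.drop_sublist (a / 2) L).countP_le (p := fun x => decide (w < |x - c|))
    rw [h3, List.length_drop] at h4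
    omega
  · have h2 : L.getD ((a - 1) / 2) 0 < c - w := by rw [hmed] at h1; linarith
    have h3 : (L.take ((a - 1) / 2 + 1)).countP (fun x => decide (w < |x - c|)) =
        (L.take ((a - 1) / 2 + 1)).length := by
      rw [List.countP_eq_length]
      intro x hx
      obtain ⟨n, hn, rfl⟩ := List.mem_iff_getElem.1 hx
      rw [List.length_take] at hn
      rw [List.getElem_take]
      have := hmono n ((a - 1) / 2) (by omega) (by omega)
      rw [List.getD_eq_getElem (n := n) _ _ (by omega)] at this
      exact decide_eq_true (lt_abs.2 (Or.inr (by linarith)))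
    have h4 := (List.take_sublist ((a - 1) / 2 + 1) L).countP_le (p := fun x => decide (w < |x - c|))
    rw [h3, List.length_take] at h4
    omega

end Median

/-! ### Concentration of the median of means. -/

section Concentration

/-- Among `a` independent events of probability at most `1 / 4`, at least half occur with
probability at most `exp (-a / 8)`. -/
lemma measure_half_of_events_le {Ω : Type*} [MeasurableSpace Ω] {μ : Measure Ω}
    [IsProbabilityMeasure μ] {W : ℕ → Ω → ℝ} (hW : ∀ l, Measurable (W l)) (hind : iIndepFun W μ)
    {B : Set ℝ} (hB : MeasurableSet B) (hp : ∀ l, μ.real (W l ⁻¹' B) ≤ 1 / 4) [DecidablePred (· ∈ B)]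
    (a : ℕ) :
    μ.real {ω | a ≤ 2 * ((Finset.range a).filter fun l => W l ω ∈ B).card} ≤
      Real.exp (-a / 8) := by
  rcases Nat.eq_zero_or_pos a with rfl | ha
  · simp
  have ha' : (0 : ℝ) < a := by exact_mod_cast ha
  set I : ℝ → ℝ := B.indicator 1 with hI
  have hIm : Measurable I := measurable_one.indicator hB
  have hE : ∀ l, ∫ ω, I (W l ω) ∂μ ≤ 1 / 4 := fun l => by
    refine le_trans (le_of_eq ?_) (hp l)
    rw [← integral_indicator_one (hW l hB)]
    rfl
  have hmem : ∀ x, I x ∈ Set.Icc (0 : ℝ) 1 := fun x => by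
    by_cases hx : x ∈ B <;> simp [hI, hx]
  set X : ℕ → Ω → ℝ := fun l ω => I (W l ω) - ∫ ω, I (W l ω) ∂μ with hX
  have hsub : ∀ l, HasSubgaussianMGF (X l) ((‖(1 : ℝ) - 0‖₊ / 2) ^ 2) μ := fun l =>
    hasSubgaussianMGF_of_mem_Icc (hIm.comp (hW l)).aemeasurable (ae_of_all _ fun ω => hmem _)
  have hXi : iIndepFun X μ := hind.comp (fun l x => I x - ∫ ω, I (W l ω) ∂μ) fun l => by fun_prop
  -- The count must exceed its mean, at most `a / 4`, by at least `a / 4`. Indicators have variance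
  -- proxy `1 / 4`, so the exponent is `(a / 4)² / (2 · a / 4) = a / 8`.
  have key := HasSubgaussianMGF.measure_sum_range_ge_le_of_iIndepFun hXi (n := a)
    (fun l _ => hsub l) (ε := a / 4) (by positivity)
  refine (measureReal_mono ?_).trans (key.trans (le_of_eq ?_))
  · intro ω hω
    simp only [Set.mem_ofPred_eq] at hω ⊢
    have h1 : ∑ l ∈ Finset.range a, I (W l ω) =
        ((Finset.range a).filter fun l => W l ω ∈ B).card := by
      rw [Finset.card_filter]
      push_cast
      refine Finset.sum_congr rfl fun l _ => ?_
      by_cases hx : W l ω ∈ B <;> simp [hI, hx]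
    have h2 : ∑ l ∈ Finset.range a, ∫ ω, I (W l ω) ∂μ ≤ a * (1 / 4) := by
      simpa using Finset.sum_le_sum fun l (_ : l ∈ Finset.range a) => hE l
    have h3 : (a : ℝ) ≤ 2 * ((Finset.range a).filter fun l => W l ω ∈ B).card := by
      exact_mod_cast hω
    simp only [hX, Finset.sum_sub_distrib, h1]
    linarith
  · congr 1
    norm_num
    field_simp
    norm_num

variable {X : Type*} [MeasurableSpace X] (ν : Measure X) [IsProbabilityMeasure ν]

/-- The mean of `G` over the `l`-th block of length `b`. -/
noncomputable def blockMean (b : ℕ) (G : X → ℝ) (l : ℕ) (v : ℕ → X) : ℝ :=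
  (1 / (b : ℝ)) * ∑ j ∈ Finset.range b, G (v (l * b + j))

lemma measurable_blockMean {G : X → ℝ} (hG : Measurable G) (b l : ℕ) :
    Measurable (blockMean b G l) := by
  unfold blockMean; fun_prop

lemma iIndepFun_blockMean {G : X → ℝ} (hG : Measurable G) (b : ℕ) :
    iIndepFun (blockMean b G) (Measure.infinitePi fun _ : ℕ => ν) := by
  -- Blocks occupy disjoint index ranges, so along this injection the sequence is an i.i.d. array,
  -- and each block mean is a function of one row.
  have hinj : Function.Injective fun p : ℕ × Fin b => p.1 * b + p.2 := by
    rintro ⟨l, j⟩ ⟨l', j'⟩ h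
    simp only at h
    have hb : 0 < b := j.pos
    have h1 : l = l' := by
      have := congrArg (· / b) h
      simpa [Nat.add_div_of_dvd_right, Nat.mul_div_cancel _ hb, mul_comm,
        Nat.mul_add_div hb, Nat.div_eq_of_lt] using this
    subst h1
    have h2 : j = j' := Fin.ext (by omega)
    rw [h2]
  have h1 := Measure.map_infinitePi_infinitePi_of_inj (P := fun _ : ℕ => ν) hinj
  have h2 := Measure.infinitePi_map_curry (fun (_ : ℕ) (_ : Fin b) => ν)
  rw [← h1, Measure.map_map (by fun_prop) (by fun_prop)] at h2
  have h3 : iIndepFun (fun (l : ℕ) (u : ℕ → Fin b → X) => (1 / (b : ℝ)) * ∑ j, G (u l j))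
      (Measure.infinitePi fun _ : ℕ => Measure.infinitePi fun _ : Fin b => ν) :=
    iIndepFun_infinitePi (X := fun _ (u : Fin b → X) => (1 / (b : ℝ)) * ∑ j, G (u j))
      fun _ => by fun_prop
  rw [← h2] at h3
  rw [iIndepFun_iff_map_fun_eq_infinitePi_map (fun l => measurable_blockMean hG b l)]
  have hφ : Measurable ((MeasurableEquiv.curry ℕ (Fin b) X) ∘
      fun (ω : ℕ → X) (p : ℕ × Fin b) => ω (p.1 * b + p.2)) := by fun_prop
  have := Measure.isProbabilityMeasure_map (μ := Measure.infinitePi fun _ : ℕ => ν) hφ.aemeasurable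
  rw [iIndepFun_iff_map_fun_eq_infinitePi_map (by fun_prop)] at h3
  rw [Measure.map_map (by fun_prop) hφ] at h3
  have h4 : ∀ l v, blockMean b G l v = (1 / (b : ℝ)) * ∑ j : Fin b,
      G (((MeasurableEquiv.curry ℕ (Fin b) X) ∘
        fun (ω : ℕ → X) (p : ℕ × Fin b) => ω (p.1 * b + p.2)) v l j) := by
    intro l v
    rw [blockMean, ← Fin.sum_univ_eq_sum_range (fun j => G (v (l * b + j)))]
    rfl
  convert h3 using 2
  · ext v l; exact h4 l v
  · ext1 l
    rw [Measure.map_map (by fun_prop) hφ]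
    congr 1
    ext v; exact h4 l v

/-- Chebyshev's inequality for the mean over a block. -/
lemma measure_blockMean_le {G : X → ℝ} (hG : Measurable G) (hL : MemLp G 2 ν) {C w : ℝ}
    (hC : ∫ x, G x ∂ν = C) (hV : variance G ν ≤ 5) {b : ℕ} (hw : 0 < w) (hb : 20 ≤ b * w ^ 2)
    (l : ℕ) :
    (Measure.infinitePi fun _ : ℕ => ν).real {v | w < |blockMean b G l v - C|} ≤ 1 / 4 := by
  set P := Measure.infinitePi fun _ : ℕ => ν
  have hb0 : (0 : ℝ) < b := by
    by_contra h
    have : (b : ℝ) = 0 := le_antisymm (not_lt.1 h) (Nat.cast_nonneg b)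
    rw [this] at hb; norm_num at hb
  have hmap : ∀ i, P.map (fun v => v i) = ν := fun i => Measure.infinitePi_map_eval _ i
  have hLi : ∀ i, MemLp (fun v : ℕ → X => G (v i)) 2 P := fun i => by
    rw [← hmap i] at hL
    exact (memLp_map_measure_iff hG.aestronglyMeasurable (measurable_pi_apply i).aemeasurable).1 hL
  have hCi : ∀ i, ∫ v, G (v i) ∂P = C := fun i => by
    rw [← hC]
    conv_rhs => rw [← hmap i]
    rw [integral_map (measurable_pi_apply i).aemeasurable hG.aestronglyMeasurable]
  have hVi : ∀ i, variance (fun v : ℕ → X => G (v i)) P ≤ 5 := fun i => by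
    refine le_trans (le_of_eq ?_) hV
    conv_rhs => rw [← hmap i]
    rw [variance_map hG.aemeasurable (measurable_pi_apply i).aemeasurable]
    rfl
  have hind : iIndepFun (fun i (v : ℕ → X) => G (v i)) P :=
    iIndepFun_infinitePi (P := fun _ : ℕ => ν) (X := fun _ x => G x) fun _ => hG
  have hsum : variance (∑ j ∈ Finset.range b, fun v : ℕ → X => G (v (l * b + j))) P ≤ 5 * b := by
    rw [IndepFun.variance_sum (fun j _ => hLi _)
      (fun i _ j _ hij => hind.indepFun (by simpa using hij))]
    refine (Finset.sum_le_sum fun j _ => hVi (l * b + j)).trans (le_of_eq ?_)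
    simp [mul_comm]
  have hE : ∫ v, blockMean b G l v ∂P = C := by
    simp only [blockMean]
    rw [integral_const_mul, integral_finsetSum _ fun j _ => (hLi _).integrable (by norm_num)]
    simp only [hCi]
    simp
    field_simp
  have hVm : variance (blockMean b G l) P ≤ 5 / b := by
    have : blockMean b G l =
        fun v => (1 / (b : ℝ)) * (∑ j ∈ Finset.range b, fun v : ℕ → X => G (v (l * b + j))) v := by
      ext v; simp [blockMean]
    rw [this, variance_const_mul]
    calc _ ≤ (1 / (b : ℝ)) ^ 2 * (5 * b) := by gcongr
      _ = 5 / b := by field_simp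
  have hLm : MemLp (blockMean b G l) 2 P :=
    (memLp_finsetSum _ fun j _ => hLi (l * b + j)).const_mul _
  have hch := meas_ge_le_variance_div_sq hLm hw
  rw [hE] at hch
  refine ENNReal.toReal_le_of_le_ofReal (by norm_num) ?_
  refine (measure_mono fun v hv => ?_).trans (hch.trans (ENNReal.ofReal_le_ofReal ?_))
  · rw [Set.mem_ofPred_eq] at hv ⊢
    exact hv.le
  -- Chebyshev gives `(5 / b) / w²`, which is at most `1 / 4` exactly when `20 ≤ b w²`.
  · rw [div_le_iff₀ (by positivity)]
    refine hVm.trans ?_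
    rw [div_le_iff₀ hb0]; nlinarith

/-- The median of means is far from the mean with exponentially small probability. -/
lemma measure_median_blockMean_le {G : X → ℝ} (hG : Measurable G) (hL : MemLp G 2 ν) {C w : ℝ}
    (hC : ∫ x, G x ∂ν = C) (hV : variance G ν ≤ 5) {a b : ℕ} (ha : 0 < a) (hw : 0 < w)
    (hb : 20 ≤ b * w ^ 2) :
    (Measure.infinitePi fun _ : ℕ => ν).real
      {v | w < |median a (fun l => blockMean b G l v) - C|} ≤ Real.exp (-a / 8) := by
  classical
  have hB : MeasurableSet {x : ℝ | w < |x - C|} :=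
    measurableSet_lt measurable_const (by fun_prop)
  refine (measureReal_mono ?_).trans (measure_half_of_events_le (fun l => measurable_blockMean hG b l)
    (iIndepFun_blockMean ν hG b) hB (fun l => measure_blockMean_le ν hG hL hC hV hw hb l) a)
  intro v hv
  have := le_two_mul_card_of_lt_abs_median a _ C w hv ha
  simpa only [Set.mem_ofPred_eq] using this

end Concentration

/-! ### Independence of the group sums of a round for given group sizes. -/

section GroupSums

lemma member_lt_of_lt (N : ℕ → ℕ) {j j' i i' : ℕ} (hj : j < j') (hi : i < N j) :
    member N j i < member N j' i' := by
  have h1 : ∑ l ∈ Finset.range (j + 1), N l ≤ ∑ l ∈ Finset.range j', N l :=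
    Finset.sum_le_sum_of_subset (Finset.range_subset_range.2 hj)
  rw [Finset.sum_range_succ] at h1
  unfold member
  omega

/-- Different positions in the groups are taken by different users. -/
lemma member_inj (N : ℕ → ℕ) {j j' i i' : ℕ} (hi : i < N j) (hi' : i' < N j')
    (h : member N j i = member N j' i') : j = j' ∧ i = i' := by
  rcases lt_trichotomy j j' with hlt | rfl | hlt
  · exact absurd h (member_lt_of_lt N hlt hi).ne
  · exact ⟨rfl, by unfold member at h; omega⟩
  · exact absurd h (member_lt_of_lt N hlt hi').ne'

variable {r k : ℕ}

/-- The sum of the hash values of group `j`, if the round starts with user `U`. -/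
def hashSum (U : ℕ) (N : ℕ → ℕ) (h : Hash r k) (s : ℕ → Fin r) (x : ℕ → Fin k) (j : ℕ) : ℤ :=
  ∑ i ∈ Finset.range (N j), (h (j, s (U + member N j i), x (U + member N j i)) : ℤ)

/-- Only the first `n` users matter. With these indexed by `Fin n` the events are automatically
measurable and match the dependent product in `map_groupData`. -/
lemma userLaw_signSum {Z : Type*} [Fintype Z] [MeasurableSpace Z] [MeasurableSingletonClass Z]
    (q : Measure Z) [IsProbabilityMeasure q] (n : ℕ) (B : Set ℤ) :
    userLaw q {z | signSum n z ∈ B} = ((signLaw Z).prod (Measure.infinitePi fun _ : Fin n => q))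
      {z | ∑ i, (z.1 (z.2 i) : ℤ) ∈ B} := by
  have h := Measure.map_infinitePi_infinitePi_of_inj (P := fun _ : ℕ => q)
    (f := fun i : Fin n => (i : ℕ)) Fin.val_injective
  have hm : Measurable fun (y : ℕ → Z) (i : Fin n) => y i := by fun_prop
  rw [← h]
  conv_rhs => rw [← Measure.map_id (μ := signLaw Z)]
  rw [Measure.map_prod_map _ _ measurable_id hm, Measure.map_apply (measurable_id.prodMap hm)]
  · unfold userLaw
    congr 1
    ext z
    simp [signSum, Finset.sum_range]
  · have : Measurable fun z : (Z → ℤˣ) × (Fin n → Z) => ∑ i, (z.1 (z.2 i) : ℤ) := .of_discrete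
    exact this .of_discrete

/-- The law of the hash functions and the salted samples of the groups of one round, for given
group sizes. -/
lemma map_groupData (q₁ : Measure (Fin r)) [IsProbabilityMeasure q₁]
    (q₂ : Measure (Fin k)) [IsProbabilityMeasure q₂] (t U : ℕ) (N : ℕ → ℕ) :
    ((Measure.infinitePi fun _ : ℕ × ℕ × Fin r × Fin k => uniformOn (Set.univ : Set ℤˣ)).prod
      ((Measure.infinitePi fun _ : ℕ => q₁).prod (Measure.infinitePi fun _ : ℕ => q₂))).map
      (fun z j => ((fun a => z.1 (t, j, a), fun i =>
        (z.2.1 (U + member N j i), z.2.2 (U + member N j i))) :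
          (Fin r × Fin k → ℤˣ) × (Fin (N j) → Fin r × Fin k))) =
    Measure.infinitePi fun j => (signLaw (Fin r × Fin k)).prod
      (Measure.infinitePi fun _ : Fin (N j) => q₁.prod q₂) := by
  have inj1 : Function.Injective fun p : ℕ × (Fin r × Fin k) => (t, p) :=
    fun p p' h => (Prod.mk.inj h).2
  -- No user occupies two positions, so the salted samples read off along the positions are again
  -- independent.
  have inj2 : Function.Injective fun p : (Σ j : ℕ, Fin (N j)) => U + member N p.1 p.2 := by
    rintro ⟨j, i⟩ ⟨j', i'⟩ h
    obtain ⟨rfl, h2⟩ := member_inj N i.2 i'.2 (Nat.add_left_cancel h)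
    rw [Fin.ext h2]
  have a1 := Measure.map_infinitePi_infinitePi_of_inj
    (P := fun _ : ℕ × ℕ × Fin r × Fin k => uniformOn (Set.univ : Set ℤˣ)) inj1
  have a2 := Measure.infinitePi_map_curry
    (fun (_ : ℕ) (_ : Fin r × Fin k) => uniformOn (Set.univ : Set ℤˣ))
  rw [← a1, Measure.map_map (by fun_prop) (by fun_prop)] at a2
  have b1 := Measure.map_infinitePi_infinitePi_of_inj (P := fun _ : ℕ => q₁.prod q₂) inj2
  have b2 := Measure.infinitePi_map_piCurry
    (fun (j : ℕ) (_ : Fin (N j)) => q₁.prod q₂)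
  rw [← b1, ← infinitePi_prod_map_zip, Measure.map_map (by fun_prop) (by fun_prop),
    Measure.map_map (by fun_prop) (by fun_prop)] at b2
  rw [← infinitePi_prod_map_zip, ← b2]
  unfold signLaw
  rw [← a2, Measure.map_prod_map _ _ (by fun_prop) (by fun_prop),
    Measure.map_map (by fun_prop) (by fun_prop)]
  rfl

/-- For given group sizes, the sums of the hash values of the groups are independent. -/
lemma measure_hashSum_cond (q₁ : Measure (Fin r)) [IsProbabilityMeasure q₁]
    (q₂ : Measure (Fin k)) [IsProbabilityMeasure q₂] (t U : ℕ) (N : ℕ → ℕ) (S : Finset ℕ)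
    (B : ℕ → Set ℤ) :
    ((Measure.infinitePi fun _ : ℕ × ℕ × Fin r × Fin k => uniformOn (Set.univ : Set ℤˣ)).prod
      ((Measure.infinitePi fun _ : ℕ => q₁).prod (Measure.infinitePi fun _ : ℕ => q₂)))
      {z | ∀ j ∈ S, hashSum U N (fun a => z.1 (t, a)) z.2.1 z.2.2 j ∈ B j} =
    ∏ j ∈ S, userLaw (q₁.prod q₂) {z | signSum (N j) z ∈ B j} := by
  have hm : ∀ j, MeasurableSet {z : (Fin r × Fin k → ℤˣ) × (Fin (N j) → Fin r × Fin k) |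
      ∑ i, (z.1 (z.2 i) : ℤ) ∈ B j} := fun j => .of_discrete
  simp_rw [userLaw_signSum]
  rw [← Measure.infinitePi_pi _ (fun j _ => hm j), ← map_groupData q₁ q₂ t U N,
    Measure.map_apply (by fun_prop) (.pi S.countable_toSet fun j _ => hm j)]
  congr 1
  ext z
  simp [hashSum, Finset.sum_range]

/-- Needed because user numbers, and so the indices at which salts and samples are read, are random.
-/
lemma measurable_eval_at {Ω ι X : Type*} [MeasurableSpace Ω] [Countable ι] [MeasurableSpace ι]
    [MeasurableSingletonClass ι] [MeasurableSpace X] {f : Ω → ι → X} (hf : Measurable f)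
    {g : Ω → ι} (hg : Measurable g) : Measurable fun ω => f ω (g ω) :=
  measurable_apply_index.comp (hf.prodMk hg)

lemma measurable_member (j i : ℕ) {Ω : Type*} [MeasurableSpace Ω] {N : Ω → ℕ → ℕ}
    (hN : Measurable N) : Measurable fun ω => member (N ω) j i := by
  unfold member; fun_prop

lemma measurable_hashSum {Ω : Type*} [MeasurableSpace Ω] {U : Ω → ℕ} {N : Ω → ℕ → ℕ}
    {h : Ω → Hash r k} {s : Ω → ℕ → Fin r} {x : Ω → ℕ → Fin k} (hU : Measurable U)
    (hN : Measurable N) (hh : Measurable h) (hs : Measurable s) (hx : Measurable x) (j : ℕ) :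
    Measurable fun ω => hashSum (U ω) (N ω) (h ω) (s ω) (x ω) j := by
  have h1 : ∀ i, Measurable fun ω => (h ω (j, s ω (U ω + member (N ω) j i),
      x ω (U ω + member (N ω) j i)) : ℤ) := fun i => by
    have hu : Measurable fun ω => U ω + member (N ω) j i := hU.add (measurable_member j i hN)
    exact (Measurable.of_discrete (f := fun u : ℤˣ => (u : ℤ))).comp
      (measurable_eval_at hh (measurable_const.prodMk
        ((measurable_eval_at hs hu).prodMk (measurable_eval_at hx hu))))
  exact measurable_eval_at (f := fun ω n => ∑ i ∈ Finset.range n, (h ω (j, s ω (U ω +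
    member (N ω) j i), x ω (U ω + member (N ω) j i)) : ℤ)) (by fun_prop) (by fun_prop)

end GroupSums

/-! ### The joint law of the group sums of a round. -/

section RoundLaw

variable {k : ℕ} (p : PMF (Fin k)) (α β δ : ℝ)

/-- The law of a salted sample. -/
noncomputable def saltedLaw : Measure (Fin (numSalts α β) × Fin k) :=
  (uniformOn (Set.univ : Set (Fin (numSalts α β)))).prod p.toMeasure

instance : IsProbabilityMeasure (saltedLaw p α β) := by unfold saltedLaw; infer_instance

/-- The sums of the hash values of the groups of round `t`. -/
noncomputable def roundSums {α β : ℝ} (δ : ℝ) (t : ℕ)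
    (ω : Seed (numSalts α β) k × (ℕ → Fin k)) (j : ℕ) : ℤ :=
  hashSum (usersBefore α β δ ω.1 t) (fun j => ω.1.1 (t, j)) (fun q => ω.1.2.1 (t, q))
    ω.1.2.2 ω.2 j

lemma measurable_usersBefore (t : ℕ) :
    Measurable fun ω : Seed (numSalts α β) k => usersBefore α β δ ω t := by
  unfold usersBefore; fun_prop

lemma measurable_roundSums (t : ℕ) : Measurable fun
    (ω : Seed (numSalts α β) k × (ℕ → Fin k)) => roundSums δ t ω := by
  refine measurable_pi_lambda _ fun j => ?_
  exact measurable_hashSum ((measurable_usersBefore α β δ t).comp measurable_fst) (by fun_prop)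
    (by fun_prop) (by fun_prop) (by fun_prop) j

/-- Reassociates so that the group sizes can be integrated last and salts stand next to samples, as
`measure_hashSum_cond` requires. -/
lemma prod_prod_prod_eq_map {A B C D : Type*} [MeasurableSpace A] [MeasurableSpace B]
    [MeasurableSpace C] [MeasurableSpace D] (a : Measure A) [IsProbabilityMeasure a]
    (b : Measure B) [IsProbabilityMeasure b] (c : Measure C) [IsProbabilityMeasure c]
    (d : Measure D) [IsProbabilityMeasure d] :
    (a.prod (b.prod c)).prod d =
      (a.prod (b.prod (c.prod d))).map fun z => ((z.1, z.2.1, z.2.2.1), z.2.2.2) := by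
  have h1 := Measure.prodAssoc_prod (μ := b) (ν := c) (τ := d)
  have h2 := Measure.prodAssoc_prod (μ := a) (ν := b.prod c) (τ := d)
  have h3 := Measure.map_prod_map a ((b.prod c).prod d) (f := id) measurable_id
    (MeasurableEquiv.measurable (MeasurableEquiv.prodAssoc (α := B) (β := C) (γ := D)))
  rw [Measure.map_id, h1] at h3
  rw [h3, ← h2, Measure.map_map (by fun_prop) (MeasurableEquiv.measurable _),
    Measure.map_map (by fun_prop) (by fun_prop)]
  exact Measure.map_id.symm

lemma fullLaw_eq_map : fullLaw p α β δ =
    ((Measure.infinitePi fun q : ℕ × ℕ => poissonMeasure (roundRate α β δ q.1).toNNReal).prod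
      ((Measure.infinitePi fun _ : ℕ × ℕ × Fin (numSalts α β) × Fin k =>
        uniformOn (Set.univ : Set ℤˣ)).prod
      ((Measure.infinitePi fun _ : ℕ => uniformOn (Set.univ : Set (Fin (numSalts α β)))).prod
        (Measure.infinitePi fun _ : ℕ => p.toMeasure)))).map
      fun z => ((z.1, z.2.1, z.2.2.1), z.2.2.2) :=
  prod_prod_prod_eq_map _ _ _ _

/-- The sums of the hash values of the groups of one round are independent and identically
distributed. -/
lemma map_roundSums (t : ℕ) :
    (fullLaw p α β δ).map (roundSums δ t) =
      Measure.infinitePi fun _ : ℕ => sumLaw (saltedLaw p α β) (roundRate α β δ t).toNNReal := by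
  refine Measure.eq_infinitePi _ fun S B hB => ?_
  have hS : MeasurableSet (Set.pi (S : Set ℕ) B) := .pi S.countable_toSet fun i _ => hB i
  have hA := measurable_roundSums (k := k) α β δ t hS
  have hφ : Measurable fun z : (ℕ × ℕ → ℕ) × (ℕ × ℕ × Fin (numSalts α β) × Fin k → ℤˣ) ×
      (ℕ → Fin (numSalts α β)) × (ℕ → Fin k) =>
      (((z.1, z.2.1, z.2.2.1), z.2.2.2) : Seed (numSalts α β) k × (ℕ → Fin k)) := by fun_prop
  rw [Measure.map_apply (measurable_roundSums α β δ t) hS, fullLaw_eq_map,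
    Measure.map_apply hφ hA, Measure.prod_apply (hφ hA)]
  have hinj : Function.Injective fun j : ℕ => (t, j) := fun j j' h => (Prod.mk.inj h).2
  have hN := Measure.map_infinitePi_infinitePi_of_inj
    (P := fun q : ℕ × ℕ => poissonMeasure (roundRate α β δ q.1).toNNReal) hinj
  calc _ = ∫⁻ N : ℕ × ℕ → ℕ, ∏ j ∈ S, userLaw (saltedLaw p α β) {z | signSum (N (t, j)) z ∈ B j}
        ∂Measure.infinitePi fun q : ℕ × ℕ => poissonMeasure (roundRate α β δ q.1).toNNReal := by
        -- Given all group sizes, the number of earlier users is a constant, and the conditional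
        -- probability does not depend on it.
        refine lintegral_congr fun N => ?_
        refine Eq.trans ?_ (measure_hashSum_cond _ _ t
          (∑ u ∈ Finset.range t, ∑ j ∈ Finset.range (roundGroups α β δ u), N (u, j))
          (fun j => N (t, j)) S B)
        rfl
    _ = ∫⁻ n : ℕ → ℕ, ∏ j ∈ S, userLaw (saltedLaw p α β) {z | signSum (n j) z ∈ B j}
        ∂Measure.infinitePi fun _ : ℕ => poissonMeasure (roundRate α β δ t).toNNReal := by
        rw [← hN, lintegral_map _ (by fun_prop)]
        exact Finset.measurable_fun_prod _ fun j _ => (measurable_from_top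
          (f := fun n : ℕ => userLaw (saltedLaw p α β) {z | signSum n z ∈ B j})).comp
            (measurable_pi_apply j)
    _ = _ := by
        rw [lintegral_prod_infinitePi _ S
          (fun j n => userLaw (saltedLaw p α β) {z | signSum n z ∈ B j})
          (fun j => measurable_from_top)]
        refine Finset.prod_congr rfl fun j _ => ?_
        rw [sumLaw, Measure.map_apply measurable_signSum_uncurry (hB j), groupLaw,
          Measure.prod_apply (measurable_signSum_uncurry (hB j))]
        rfl

end RoundLaw

/-! ### Inequalities between the parameters of a round. -/

section Parameters

variable {α β δ : ℝ}

lemma one_le_numSalts (α β : ℝ) : (1 : ℝ) ≤ numSalts α β := by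
  exact_mod_cast le_max_left _ _

lemma log_one_div_failProb (hδ : 0 < δ) (t : ℕ) :
    Real.log (1 / failProb δ t) = Real.log (1 / δ) + (t + 1) * Real.log 2 := by
  have h : 1 / failProb δ t = (1 / δ) * 2 ^ (t + 1) := by
    unfold failProb; field_simp
  rw [h, Real.log_mul (by positivity) (by positivity), Real.log_pow]
  push_cast; ring

lemma log_one_div_nonneg (hδ : 0 < δ) (hδ1 : δ ≤ 1) : 0 ≤ Real.log (1 / δ) :=
  Real.log_nonneg (by rw [le_div_iff₀ hδ]; linarith)

/-- Already `8 log 2 > 5`, and the number is rounded up. -/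
lemma six_le_roundSupergroups (hδ : 0 < δ) (hδ1 : δ ≤ 1) (t : ℕ) : 6 ≤ roundSupergroups δ t := by
  unfold roundSupergroups numSupergroups
  rw [log_one_div_failProb hδ]
  have h1 := log_one_div_nonneg hδ hδ1
  have h2 := Real.log_two_gt_d9
  have h3 : (0 : ℝ) ≤ t := t.cast_nonneg
  refine Nat.succ_le_of_lt (Nat.lt_ceil.2 ?_)
  push_cast
  nlinarith

/-- The number of supergroups grows slowly. -/
lemma roundSupergroups_le (hδ : 0 < δ) (hδ1 : δ ≤ 1) (t : ℕ) :
    roundSupergroups δ t ≤ roundSupergroups δ 0 * (1 + t) := by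
  have h6 : (6 : ℝ) ≤ roundSupergroups δ 0 := by exact_mod_cast six_le_roundSupergroups hδ hδ1 0
  have h0 : 8 * Real.log (1 / failProb δ 0) ≤ roundSupergroups δ 0 := Nat.le_ceil _
  conv_lhs => unfold roundSupergroups numSupergroups
  rw [Nat.ceil_le]
  rw [log_one_div_failProb hδ] at h0 ⊢
  push_cast at h0 ⊢
  -- Each round adds `8 log 2 < 6 ≤ a₀` before rounding.
  have h2 := Real.log_two_lt_d9
  have h3 : (0 : ℝ) ≤ t := t.cast_nonneg
  nlinarith

lemma sampleSize_pos (hδ : 0 < δ) (hδ1 : δ ≤ 1) (t : ℕ) : 0 < sampleSize α β δ t := by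
  have h6 : (6 : ℝ) ≤ numSupergroups (failProb δ 0) := by
    exact_mod_cast six_le_roundSupergroups hδ hδ1 0
  have := one_le_numSalts α β
  unfold sampleSize
  positivity

lemma radius_sq (hδ : 0 < δ) (hδ1 : δ ≤ 1) (t : ℕ) :
    radius α β δ t ^ 2 = roundSupergroups δ t / (roundSupergroups δ 0 * 2 ^ t) := by
  have hn := sampleSize_pos (α := α) (β := β) hδ hδ1 t
  unfold radius
  rw [Real.sq_sqrt (by positivity)]
  have h6 : (6 : ℝ) ≤ numSupergroups (failProb δ 0) := by
    exact_mod_cast six_le_roundSupergroups hδ hδ1 0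
  have := one_le_numSalts α β
  unfold sampleSize roundSupergroups
  field_simp

lemma radius_sq_mul_sampleSize (hδ : 0 < δ) (hδ1 : δ ≤ 1) (t : ℕ) :
    radius α β δ t ^ 2 * sampleSize α β δ t = 160 * roundSupergroups δ t * numSalts α β := by
  have hn := sampleSize_pos (α := α) (β := β) hδ hδ1 t
  unfold radius
  rw [Real.sq_sqrt (by positivity)]
  unfold roundSupergroups
  field_simp

lemma radius_pos (hδ : 0 < δ) (hδ1 : δ ≤ 1) (t : ℕ) : 0 < radius α β δ t := by
  have hn := sampleSize_pos (α := α) (β := β) hδ hδ1 t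
  have h6 : (6 : ℝ) ≤ numSupergroups (failProb δ t) := by
    exact_mod_cast six_le_roundSupergroups hδ hδ1 t
  have := one_le_numSalts α β
  unfold radius
  positivity

/-- The factor `1 + t` is the price of the shrinking failure probabilities; it is the source of a
logarithm of `1 / ε` in the sample bound. -/
lemma radius_sq_le (hδ : 0 < δ) (hδ1 : δ ≤ 1) (t : ℕ) :
    radius α β δ t ^ 2 ≤ (1 + t) / 2 ^ t := by
  have h6 : (6 : ℝ) ≤ roundSupergroups δ 0 := by exact_mod_cast six_le_roundSupergroups hδ hδ1 0
  have h1 : (roundSupergroups δ t : ℝ) ≤ roundSupergroups δ 0 * (1 + t) := by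
    exact_mod_cast roundSupergroups_le hδ hδ1 t
  rw [radius_sq hδ hδ1, div_le_div_iff₀ (by positivity) (by positivity)]
  calc _ ≤ (roundSupergroups δ 0 * (1 + t) : ℝ) * 2 ^ t := by gcongr
    _ = _ := by ring

lemma radius_sq_le_one (hδ : 0 < δ) (hδ1 : δ ≤ 1) (t : ℕ) : radius α β δ t ^ 2 ≤ 1 := by
  refine (radius_sq_le hδ hδ1 t).trans ?_
  rw [div_le_one (by positivity)]
  have := t.lt_two_pow_self
  have h : t + 1 ≤ 2 ^ t := this
  have h' : ((t + 1 : ℕ) : ℝ) ≤ ((2 ^ t : ℕ) : ℝ) := by exact_mod_cast h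
  push_cast at h'
  linarith

lemma twenty_le_groupsPer (hδ : 0 < δ) (hδ1 : δ ≤ 1) (t : ℕ) :
    20 ≤ (roundGroupsPer α β δ t : ℝ) * radius α β δ t ^ 2 := by
  have hw := radius_pos (α := α) (β := β) hδ hδ1 t
  rw [← div_le_iff₀ (by positivity)]
  exact Nat.le_ceil _

/-- Rounding `20 / w²` up costs at most `w² ≤ 1`. Few groups mean large groups, which the variance
bound needs. -/
lemma groupsPer_le (hδ : 0 < δ) (hδ1 : δ ≤ 1) (t : ℕ) :
    (roundGroupsPer α β δ t : ℝ) * radius α β δ t ^ 2 ≤ 21 := by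
  have hw := radius_pos (α := α) (β := β) hδ hδ1 t
  have h1 := radius_sq_le_one (α := α) (β := β) hδ hδ1 t
  have h2 : (roundGroupsPer α β δ t : ℝ) ≤ 20 / radius α β δ t ^ 2 + 1 :=
    (Nat.ceil_lt_add_one (by positivity)).le
  calc _ ≤ (20 / radius α β δ t ^ 2 + 1) * radius α β δ t ^ 2 := by gcongr
    _ = 20 + radius α β δ t ^ 2 := by field_simp
    _ ≤ 21 := by linarith

lemma roundGroups_pos (hδ : 0 < δ) (hδ1 : δ ≤ 1) (t : ℕ) :
    (0 : ℝ) < roundGroups α β δ t := by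
  have h1 := six_le_roundSupergroups hδ hδ1 t
  have h2 := twenty_le_groupsPer (α := α) (β := β) hδ hδ1 t
  have h3 : (0 : ℝ) < roundGroupsPer α β δ t := by
    by_contra h
    have : (roundGroupsPer α β δ t : ℝ) = 0 := le_antisymm (not_lt.1 h) (Nat.cast_nonneg _)
    rw [this] at h2; norm_num at h2
  unfold roundGroups
  push_cast
  have : (6 : ℝ) ≤ roundSupergroups δ t := by exact_mod_cast h1
  positivity

lemma roundRate_pos (hδ : 0 < δ) (hδ1 : δ ≤ 1) (t : ℕ) : 0 < roundRate α β δ t :=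
  div_pos (sampleSize_pos hδ hδ1 t) (roundGroups_pos hδ hδ1 t)

/-- The groups are large compared to the number of salts. -/
lemma numSalts_le_roundRate (hδ : 0 < δ) (hδ1 : δ ≤ 1) (t : ℕ) :
    160 * (numSalts α β : ℝ) ≤ 21 * roundRate α β δ t := by
  have hg := roundGroups_pos (α := α) (β := β) hδ hδ1 t
  have h1 := groupsPer_le (α := α) (β := β) hδ hδ1 t
  have h2 := radius_sq_mul_sampleSize (α := α) (β := β) hδ hδ1 t
  have hw := radius_pos (α := α) (β := β) hδ hδ1 t
  unfold roundRate
  rw [← mul_div_assoc, le_div_iff₀ hg]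
  have hw2 : 0 < radius α β δ t ^ 2 := by positivity
  refine le_of_mul_le_mul_left ?_ hw2
  calc _ = (160 * roundSupergroups δ t * numSalts α β) *
        (roundGroupsPer α β δ t * radius α β δ t ^ 2) := by unfold roundGroups; push_cast; ring
    _ ≤ (160 * roundSupergroups δ t * numSalts α β) * 21 := by gcongr
    _ = _ := by rw [← h2]; ring

/-- The factor 8 in the number of supergroups cancels the 8 in the tail `exp (-a / 8)` of the
median. -/
lemma exp_neg_roundSupergroups_le (hδ : 0 < δ) (t : ℕ) :
    Real.exp (-(roundSupergroups δ t : ℝ) / 8) ≤ failProb δ t := by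
  have h : 8 * Real.log (1 / failProb δ t) ≤ roundSupergroups δ t := Nat.le_ceil _
  have hf : 0 < failProb δ t := by unfold failProb; positivity
  rw [← Real.le_log_iff_exp_le hf]
  rw [one_div, Real.log_inv] at h
  linarith

end Parameters

/-! ### Accuracy of each round, and the null hypothesis. -/

section RoundFailure

variable {k : ℕ} (p : PMF (Fin k)) {α β δ : ℝ}

lemma sum_toReal_eq_one : ∑ i, (p i).toReal = 1 := by
  have h := p.tsum_coe
  rw [tsum_fintype] at h
  rw [← ENNReal.toReal_sum fun i _ => p.apply_ne_top i, h, ENNReal.toReal_one]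

lemma collisionProb_le_one : collisionProb p ≤ 1 := by
  rw [← sum_toReal_eq_one p]
  refine Finset.sum_le_sum fun i _ => ?_
  have h1 : (p i).toReal ≤ 1 := ENNReal.toReal_mono ENNReal.one_ne_top (p.coe_le_one i)
  nlinarith [ENNReal.toReal_nonneg (a := p i)]

/-- Salting splits each `p i` into `r` equal atoms, which divides the collision probability by `r`;
the factor `r` in `groupEstimate` undoes this. -/
lemma sum_sq_saltedLaw :
    numSalts α β * ∑ z, (saltedLaw p α β).real {z} ^ 2 = collisionProb p := by
  have h : ∀ z : Fin (numSalts α β) × Fin k,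
      (saltedLaw p α β).real {z} = (numSalts α β : ℝ)⁻¹ * (p z.2).toReal := by
    rintro ⟨s, i⟩
    rw [saltedLaw, ← Set.singleton_prod_singleton, measureReal_prod_prod]
    congr 1
    · rw [Measure.real, uniformOn_univ]
      simp
    · rw [Measure.real, PMF.toMeasure_apply_singleton _ _ (measurableSet_singleton _)]
  simp_rw [h, mul_pow]
  rw [← Finset.mul_sum, Fintype.sum_prod_type]
  have := one_le_numSalts α β
  simp only [Finset.sum_const, Finset.card_univ, Fintype.card_fin, nsmul_eq_mul, collisionProb]
  field_simp

lemma groupSum_roundTranscript (x : ℕ → Fin k) (ω : Seed (numSalts α β) k) (t j : ℕ)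
    (hj : j < roundGroups α β δ t) :
    groupSum (roundTranscript α β δ x ω t) j = (roundSums δ t (ω, x) j : ℝ) := by
  unfold groupSum roundSums hashSum roundTranscript runTranscript
  push_cast
  simp only [hj, if_true, true_and]
  refine Finset.sum_congr rfl fun i hi => ?_
  rw [if_pos (Finset.mem_range.1 hi)]

/-- Only blocks `l < a` enter the median, and their indices stay below `a b`, where the transcript
records the true group sizes. This lets an infinite i.i.d. sequence replace the finitely many
groups. -/
lemma roundEstimate_eq_median (x : ℕ → Fin k) (ω : Seed (numSalts α β) k) (t : ℕ) :
    roundEstimate α β δ x ω t = median (roundSupergroups δ t) fun l =>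
      blockMean (roundGroupsPer α β δ t) (fun v : ℤ => numSalts α β *
        ((v : ℝ) ^ 2 - roundRate α β δ t) / roundRate α β δ t ^ 2) l (roundSums δ t (ω, x)) := by
  unfold roundEstimate estimate
  refine median_congr fun l hl => ?_
  unfold blockMean
  congr 1
  refine Finset.sum_congr rfl fun j hj => ?_
  have hlt : l * roundGroupsPer α β δ t + j < roundGroups α β δ t := by
    have h1 : (l + 1) * roundGroupsPer α β δ t ≤ roundGroups α β δ t :=
      Nat.mul_le_mul_right _ hl
    have := Finset.mem_range.1 hj
    rw [add_mul] at h1; omega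
  rw [groupEstimate, groupSum_roundTranscript x ω t _ hlt]

/-- The estimate of round `t` is within `radius t` of the collision probability, with probability
at least `1 - failProb t`. -/
lemma measure_far_le (hδ : 0 < δ) (hδ1 : δ ≤ 1) (t : ℕ) :
    fullLaw p α β δ {ω | radius α β δ t < |roundEstimate α β δ ω.2 ω.1 t - collisionProb p|} ≤
      ENNReal.ofReal (failProb δ t) := by
  set G : ℤ → ℝ := fun v => numSalts α β *
        ((v : ℝ) ^ 2 - roundRate α β δ t) / roundRate α β δ t ^ 2 with hG
  have hrate : ((roundRate α β δ t).toNNReal : ℝ) = roundRate α β δ t :=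
    Real.coe_toNNReal _ (roundRate_pos hδ hδ1 t).le
  set q := saltedLaw p α β
  set m := (roundRate α β δ t).toNNReal with hm
  have hm0 : 0 < m := Real.toNNReal_pos.2 (roundRate_pos hδ hδ1 t)
  have hL : MemLp G 2 (sumLaw q m) := by
    have := memLp_estimate_sumLaw q m (numSalts α β)
    rwa [hrate] at this
  have hC : ∫ v, G v ∂sumLaw q m = collisionProb p := by
    have := integral_estimate_sumLaw q m (numSalts α β) hm0
    rwa [hrate, sum_sq_saltedLaw] at this
  have hV : variance G (sumLaw q m) ≤ 5 := by
    have := variance_estimate_sumLaw q m (numSalts α β)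
      (by exact_mod_cast one_le_numSalts α β)
      (by rw [hrate]; exact numSalts_le_roundRate hδ hδ1 t)
      (by rw [sum_sq_saltedLaw]; exact collisionProb_le_one p)
    rwa [hrate] at this
  have hGm : Measurable G := measurable_from_top
  have key := measure_median_blockMean_le (sumLaw q m) hGm hL hC hV
    (a := roundSupergroups δ t) (b := roundGroupsPer α β δ t) (w := radius α β δ t)
    (by have := six_le_roundSupergroups hδ hδ1 t; omega) (radius_pos hδ hδ1 t)
    (twenty_le_groupsPer hδ hδ1 t)
  rw [← map_roundSums p α β δ t] at key
  have h1 := ENNReal.ofReal_le_ofReal (key.trans (exp_neg_roundSupergroups_le hδ t))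
  have := Measure.isProbabilityMeasure_map (μ := fullLaw p α β δ)
    (measurable_roundSums (k := k) α β δ t).aemeasurable
  rw [Measure.real, ENNReal.ofReal_toReal (measure_ne_top _ _)] at h1
  refine le_trans ?_ h1
  -- Only an upper bound is needed, and this inequality holds without measurability of the event.
  refine le_trans (le_of_eq ?_) (Measure.le_map_apply
    (measurable_roundSums (k := k) α β δ t).aemeasurable _)
  congr 1
  ext ω
  simp only [Set.mem_ofPred_eq, Set.mem_preimage, roundEstimate_eq_median]
  rfl

/-- A set is likely if its complement is covered by an unlikely set. -/
lemma one_sub_le_of_compl_subset {Ω : Type*} [MeasurableSpace Ω] {μ : Measure Ω}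
    [IsProbabilityMeasure μ] {A B : Set Ω} (h : Aᶜ ⊆ B) (hδ : 0 ≤ δ)
    (hB : μ B ≤ ENNReal.ofReal δ) : ENNReal.ofReal (1 - δ) ≤ μ A := by
  -- Subadditivity suffices, so neither set has to be measurable.
  have h1 : 1 ≤ μ A + μ B := by
    rw [← measure_univ (μ := μ), ← Set.union_compl_self A]
    exact (measure_union_le _ _).trans (by gcongr)
  rw [ENNReal.ofReal_sub _ hδ, ENNReal.ofReal_one, tsub_le_iff_right]
  exact h1.trans (by gcongr)

lemma tsum_failProb (hδ : 0 < δ) : ∑' t, ENNReal.ofReal (failProb δ t) = ENNReal.ofReal δ := by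
  have h : HasSum (failProb δ) δ := by
    have := (hasSum_geometric_two' δ)
    refine this.congr_fun ?_
    intro t; unfold failProb; rw [pow_succ]; field_simp
  rw [← h.tsum_eq, ENNReal.ofReal_tsum_of_nonneg _ h.summable]
  · rw [h.tsum_eq]
  · intro t; unfold failProb; positivity

/-- Under the null hypothesis the tester never rejects, with probability at least `1 - δ`. -/
lemma never_rejects (hδ : 0 < δ) (hδ1 : δ ≤ 1) {c₀ : ℝ} (h : collisionProb p = c₀) :
    ENNReal.ofReal (1 - δ) ≤ fullLaw p α β δ {ω | ∀ t, ¬ RejectsAt c₀ α β δ ω.2 ω.1 t} := by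
  refine one_sub_le_of_compl_subset (B := ⋃ t, {ω | radius α β δ t <
    |roundEstimate α β δ ω.2 ω.1 t - collisionProb p|}) ?_ hδ.le ?_
  · intro ω hω
    simp only [Set.mem_compl_iff, Set.mem_ofPred_eq, not_forall, not_not] at hω
    obtain ⟨t, ht⟩ := hω
    refine Set.mem_iUnion.2 ⟨t, ?_⟩
    simp only [Set.mem_ofPred_eq, h]
    exact ht.1
  · rw [← tsum_failProb hδ]
    exact (measure_iUnion_le _).trans (ENNReal.tsum_le_tsum fun t => measure_far_le p hδ hδ1 t)

end RoundFailure

/-! ### Tail of the number of users, and rejection under the alternative. -/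

section UserCount

/-- The Poisson generating function `exp ((s - 1) m)` at `s = 2`. -/
lemma lintegral_two_pow_poisson (m : ℝ≥0) :
    ∫⁻ n : ℕ, (2 : ENNReal) ^ n ∂poissonMeasure m = ENNReal.ofReal (Real.exp m) := by
  have h1 : HasSum (fun n : ℕ => (Real.exp (-m) * m ^ n / (n.factorial : ℝ)) * (2 : ℝ) ^ n)
      (Real.exp m) := by
    have := (hasSum_one_poissonMeasure (2 * m)).mul_left (Real.exp m)
    rw [mul_one] at this
    refine this.congr_fun ?_
    intro n
    have : Real.exp (-m) = Real.exp m * Real.exp (-(2 * m : ℝ≥0)) := by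
      rw [← Real.exp_add]; congr 1; push_cast; ring
    rw [this]; push_cast; rw [mul_pow]; ring
  have h2 : Integrable (fun n : ℕ => (2 : ℝ) ^ n) (poissonMeasure m) := by
    rw [integrable_poissonMeasure_iff]
    simpa using h1.summable
  have h3 := ofReal_integral_eq_lintegral_ofReal h2 (ae_of_all _ fun n => by positivity)
  rw [integral_poissonMeasure] at h3
  simp only [smul_eq_mul] at h3
  rw [h1.tsum_eq] at h3
  rw [h3]
  refine lintegral_congr fun n => ?_
  rw [ENNReal.ofReal_pow (by norm_num)]; simp

variable {k : ℕ} (p : PMF (Fin k)) {α β δ : ℝ}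

/-- The expected number of users in the rounds before round `t`. -/
noncomputable def expectedUsers (α β δ : ℝ) (t : ℕ) : ℝ :=
  ∑ u ∈ Finset.range t, sampleSize α β δ u

/-- The sizes are independent over rounds and groups, so the generating functions multiply; the `g`
groups of a round, each of rate `n / g`, together contribute `exp n`. -/
lemma lintegral_two_pow_usersBefore (hδ : 0 < δ) (hδ1 : δ ≤ 1) (t : ℕ) :
    ∫⁻ ω, (2 : ENNReal) ^ usersBefore α β δ ω.1 t ∂fullLaw p α β δ =
      ENNReal.ofReal (Real.exp (expectedUsers α β δ t)) := by
  have hfst : (fullLaw p α β δ).map (fun ω => ω.1.1) =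
      Measure.infinitePi fun q : ℕ × ℕ => poissonMeasure (roundRate α β δ q.1).toNNReal := by
    have h1 : (fullLaw p α β δ).map Prod.fst = seedLaw k α β δ := Measure.fst_prod
    have h2 : (seedLaw k α β δ).map Prod.fst =
      Measure.infinitePi fun q : ℕ × ℕ => poissonMeasure (roundRate α β δ q.1).toNNReal :=
        Measure.fst_prod
    rw [← h2, ← h1, Measure.map_map (by fun_prop) (by fun_prop)]
    rfl
  have hcurry := Measure.infinitePi_map_curry
    (fun (u : ℕ) (_ : ℕ) => poissonMeasure (roundRate α β δ u).toNNReal)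
  have hm2 : ∀ g : ℕ, Measurable fun N : ℕ → ℕ => ∏ j ∈ Finset.range g, (2 : ENNReal) ^ N j :=
    fun g => Finset.measurable_fun_prod _ fun j _ =>
      (measurable_from_top (f := fun n : ℕ => (2 : ENNReal) ^ n)).comp (measurable_pi_apply j)
  calc _ = ∫⁻ ω, (fun N : ℕ × ℕ → ℕ => (fun N : ℕ → ℕ → ℕ => ∏ u ∈ Finset.range t,
            ∏ j ∈ Finset.range (roundGroups α β δ u), (2 : ENNReal) ^ N u j)
          (MeasurableEquiv.curry ℕ ℕ ℕ N)) ω.1.1 ∂fullLaw p α β δ := by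
        refine lintegral_congr fun ω => ?_
        unfold usersBefore
        simp_rw [Finset.prod_pow_eq_pow_sum]
        rfl
    _ = ∫⁻ N : ℕ → ℕ → ℕ, ∏ u ∈ Finset.range t,
            ∏ j ∈ Finset.range (roundGroups α β δ u), (2 : ENNReal) ^ N u j
          ∂Measure.infinitePi fun u => Measure.infinitePi fun _ : ℕ =>
            poissonMeasure (roundRate α β δ u).toNNReal := by
        have hm3 : Measurable fun N : ℕ → ℕ → ℕ => ∏ u ∈ Finset.range t,
            ∏ j ∈ Finset.range (roundGroups α β δ u), (2 : ENNReal) ^ N u j :=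
          Finset.measurable_fun_prod _ fun u _ => (hm2 _).comp (measurable_pi_apply u)
        rw [← hcurry, lintegral_map hm3 (MeasurableEquiv.measurable _), ← hfst]
        exact (lintegral_map (hm3.comp (MeasurableEquiv.measurable (MeasurableEquiv.curry ℕ ℕ ℕ)))
          (by fun_prop)).symm
    _ = ∏ u ∈ Finset.range t, ∏ j ∈ Finset.range (roundGroups α β δ u),
          ENNReal.ofReal (Real.exp (roundRate α β δ u)) := by
        rw [lintegral_prod_infinitePi _ _ (fun u (N : ℕ → ℕ) =>
          ∏ j ∈ Finset.range (roundGroups α β δ u), (2 : ENNReal) ^ N j) fun u => hm2 _]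
        refine Finset.prod_congr rfl fun u _ => ?_
        rw [lintegral_prod_infinitePi _ _ (fun _ (n : ℕ) => (2 : ENNReal) ^ n)
          fun u => measurable_from_top]
        refine Finset.prod_congr rfl fun j _ => ?_
        rw [lintegral_two_pow_poisson, Real.coe_toNNReal _ (roundRate_pos hδ hδ1 u).le]
    _ = _ := by
        unfold expectedUsers
        rw [Real.exp_sum, ENNReal.ofReal_prod_of_nonneg fun _ _ => (Real.exp_pos _).le]
        refine Finset.prod_congr rfl fun u _ => ?_
        rw [Finset.prod_const, Finset.card_range, ← ENNReal.ofReal_pow (Real.exp_pos _).le,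
          ← Real.exp_nat_mul]
        congr 2
        have := roundGroups_pos (α := α) (β := β) hδ hδ1 u
        unfold roundRate
        field_simp

/-- The number of users exceeds four times its mean with exponentially small probability. -/
lemma measure_usersBefore_gt_le (hδ : 0 < δ) (hδ1 : δ ≤ 1) (t : ℕ) :
    fullLaw p α β δ {ω | 4 * expectedUsers α β δ t < usersBefore α β δ ω.1 t} ≤
      ENNReal.ofReal (Real.exp (-expectedUsers α β δ t)) := by
  set M := expectedUsers α β δ t with hM
  have hM0 : 0 ≤ M := Finset.sum_nonneg fun u _ => (sampleSize_pos hδ hδ1 u).le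
  set f : Seed (numSalts α β) k × (ℕ → Fin k) → ENNReal :=
    fun ω => (2 : ENNReal) ^ usersBefore α β δ ω.1 t with hf
  have hfm : Measurable f :=
    (measurable_from_top (f := fun n : ℕ => (2 : ENNReal) ^ n)).comp
      ((measurable_usersBefore α β δ t).comp measurable_fst)
  have hsub : {ω : Seed (numSalts α β) k × (ℕ → Fin k) | 4 * M < usersBefore α β δ ω.1 t} ⊆
      {ω | ENNReal.ofReal (Real.exp (2 * M)) ≤ f ω} := by
    intro ω hω
    simp only [Set.mem_ofPred_eq] at hω ⊢
    have h2 : (2 : ENNReal) = ENNReal.ofReal (Real.exp (Real.log 2)) := by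
      rw [Real.exp_log (by norm_num)]; simp
    rw [hf]
    simp only
    rw [h2, ← ENNReal.ofReal_pow (Real.exp_pos _).le, ← Real.exp_nat_mul]
    refine ENNReal.ofReal_le_ofReal (Real.exp_le_exp.2 ?_)
    -- `2 ^ (4 M) ≥ exp (2 M)` because `log 2 ≥ 1 / 2`.
    have := Real.log_two_gt_d9
    nlinarith
  refine (measure_mono hsub).trans ((meas_ge_le_lintegral_div hfm.aemeasurable ?_ ?_).trans ?_)
  · exact (ENNReal.ofReal_pos.2 (Real.exp_pos _)).ne'
  · exact ENNReal.ofReal_ne_top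
  · rw [hf, lintegral_two_pow_usersBefore p hδ hδ1, ← ENNReal.ofReal_div_of_pos (Real.exp_pos _),
      ← Real.exp_sub]
    refine ENNReal.ofReal_le_ofReal (Real.exp_le_exp.2 ?_)
    linarith

lemma usersBefore_mono (ω : Seed (numSalts α β) k) : Monotone (usersBefore α β δ ω) :=
  fun _ _ h => Finset.sum_le_sum_of_subset (Finset.range_subset_range.2 h)

lemma expectedUsers_succ_le (α β δ : ℝ) (t : ℕ) : expectedUsers α β δ (t + 1) ≤
    320 * roundSupergroups δ 0 * numSalts α β * 2 ^ t := by
  unfold expectedUsers sampleSize roundSupergroups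
  rw [← Finset.mul_sum, geom_sum_eq (by norm_num), pow_succ]
  have h : (0 : ℝ) ≤ 160 * numSupergroups (failProb δ 0) * numSalts α β := by positivity
  nlinarith [pow_pos (two_pos (α := ℝ)) t]

/-- Round 0 alone is this large, since `a₀ ≥ 8 log (2 / δ)`. It turns the tail `exp (-M)` of the
user count into `δ / 2`. -/
lemma log_le_expectedUsers (hδ : 0 < δ) (hδ1 : δ ≤ 1) (t : ℕ) :
    Real.log (2 / δ) ≤ expectedUsers α β δ (t + 1) := by
  have h1 : sampleSize α β δ 0 ≤ expectedUsers α β δ (t + 1) :=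
    Finset.single_le_sum (f := sampleSize α β δ) (fun u _ => (sampleSize_pos hδ hδ1 u).le)
      (Finset.mem_range.2 t.succ_pos)
  refine le_trans ?_ h1
  have h2 : 8 * Real.log (1 / failProb δ 0) ≤ numSupergroups (failProb δ 0) := Nat.le_ceil _
  have h3 : 1 / failProb δ 0 = 2 / δ := by unfold failProb; field_simp; norm_num
  rw [h3] at h2
  have h4 : 0 ≤ Real.log (2 / δ) := Real.log_nonneg (by rw [le_div_iff₀ hδ]; linarith)
  have h5 := one_le_numSalts α β
  unfold sampleSize
  nlinarith

/-- The tester rejects by the end of round `T`, if `radius T` is small enough. -/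
lemma rejectsWithin_of_round (hδ : 0 < δ) (hδ1 : δ ≤ 1) {c₀ ε B : ℝ} (hε : 0 < ε)
    (h : ε ≤ |collisionProb p - c₀|) {T : ℕ} (hT : 4 * (1 + T) < ε ^ 2 * 2 ^ T)
    (hB : 1280 * roundSupergroups δ 0 * numSalts α β * 2 ^ T ≤ B) :
    ENNReal.ofReal (1 - δ) ≤ fullLaw p α β δ {ω | RejectsWithin c₀ α β δ B ω.2 ω.1} := by
  classical
  have hw : 2 * radius α β δ T < ε := by
    have h1 := radius_sq_le (α := α) (β := β) hδ hδ1 T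
    have h2 := radius_pos (α := α) (β := β) hδ hδ1 T
    rw [le_div_iff₀ (by positivity)] at h1
    have h3 : (2 * radius α β δ T) ^ 2 < ε ^ 2 := by
      refine lt_of_mul_lt_mul_right (a := (2 : ℝ) ^ T) ?_ (by positivity)
      nlinarith
    exact lt_of_pow_lt_pow_left₀ 2 hε.le h3
  have hM := expectedUsers_succ_le α β δ T
  refine one_sub_le_of_compl_subset (B := {ω | radius α β δ T <
    |roundEstimate α β δ ω.2 ω.1 T - collisionProb p|} ∪
    {ω | 4 * expectedUsers α β δ (T + 1) < usersBefore α β δ ω.1 (T + 1)}) ?_ hδ.le ?_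
  · rw [Set.compl_subset_comm]
    intro ω hω
    simp only [Set.mem_compl_iff, Set.mem_union, Set.mem_ofPred_eq, not_or, not_lt] at hω ⊢
    obtain ⟨h1, h2⟩ := hω
    have hE : Exceeds c₀ α β δ ω.2 ω.1 T := by
      unfold Exceeds
      have := abs_sub_abs_le_abs_sub (collisionProb p - c₀)
        (collisionProb p - roundEstimate α β δ ω.2 ω.1 T)
      rw [sub_sub_sub_cancel_left, abs_sub_comm (collisionProb p) (roundEstimate _ _ _ _ _ _)] at this
      linarith
    have hex : ∃ t, Exceeds c₀ α β δ ω.2 ω.1 t := ⟨T, hE⟩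
    -- Rejection happens at the first round that exceeds its threshold, possibly before `T`, with no
    -- more users than through round `T`.
    refine ⟨Nat.find hex, ⟨Nat.find_spec hex, fun u hu => Nat.find_min hex hu⟩, ?_⟩
    have h3 : usersBefore α β δ ω.1 (Nat.find hex + 1) ≤ usersBefore α β δ ω.1 (T + 1) :=
      usersBefore_mono ω.1 (Nat.succ_le_succ (Nat.find_min' hex hE))
    have h4 : (usersBefore α β δ ω.1 (Nat.find hex + 1) : ℝ) ≤ usersBefore α β δ ω.1 (T + 1) := by
      exact_mod_cast h3
    linarith
  · refine (measure_union_le _ _).trans ((add_le_add (measure_far_le p hδ hδ1 T)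
      (measure_usersBefore_gt_le p hδ hδ1 (T + 1))).trans ?_)
    rw [← ENNReal.ofReal_add (by unfold failProb; positivity) (Real.exp_pos _).le]
    refine ENNReal.ofReal_le_ofReal ?_
    -- Half of `δ` pays for an inaccurate estimate, half for too many users.
    have h1 : failProb δ T ≤ δ / 2 := by
      unfold failProb
      gcongr
      exact le_self_pow₀ (by norm_num) (by omega)
    have h2 : Real.exp (-expectedUsers α β δ (T + 1)) ≤ δ / 2 := by
      rw [← Real.le_log_iff_exp_le (by positivity)]
      have := log_le_expectedUsers (α := α) (β := β) hδ hδ1 T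
      rw [← inv_div, Real.log_inv]
      linarith
    linarith

end UserCount

/-! ### The explicit sample bound. -/

section SampleBound

/-- There is a round with small radius that is not too late. -/
lemma exists_round {ε : ℝ} (hε : 0 < ε) (hε1 : ε < 1) :
    ∃ T : ℕ, 4 * (1 + T) < ε ^ 2 * 2 ^ T ∧
      (2 : ℝ) ^ T ≤ 8 * (6 + 5 * Real.log (1 / ε)) / ε ^ 2 := by
  classical
  have hex : ∃ T : ℕ, 4 * (1 + (T : ℝ)) < ε ^ 2 * 2 ^ T := by
    have h1 : Filter.Tendsto (fun n : ℕ => (n : ℝ) ^ 1 / 2 ^ n) Filter.atTop (nhds 0) :=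
      tendsto_pow_const_div_const_pow_of_one_lt 1 (by norm_num)
    have h2 := (h1.eventually_lt_const (show (0 : ℝ) < ε ^ 2 / 8 by positivity)).and
      (Filter.eventually_ge_atTop 1)
    obtain ⟨n, hn, hn1⟩ := h2.exists
    refine ⟨n, ?_⟩
    rw [div_lt_iff₀ (by positivity), pow_one] at hn
    have : (1 : ℝ) ≤ n := by exact_mod_cast hn1
    linarith
  refine ⟨Nat.find hex, Nat.find_spec hex, ?_⟩
  have hmin := fun n => Nat.find_min (m := n) hex
  obtain ⟨T, hT⟩ : ∃ T, Nat.find hex = T := ⟨_, rfl⟩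
  rw [hT] at hmin ⊢
  have hL : Real.log (1 / ε) = -Real.log ε := by rw [one_div, Real.log_inv]
  have hL0 : 0 < Real.log (1 / ε) := Real.log_pos (by rw [lt_div_iff₀ hε]; linarith)
  rcases T with _ | n
  · rw [pow_zero, le_div_iff₀ (by positivity)]
    nlinarith
  · have h1 := hmin n (Nat.lt_succ_self n)
    rw [not_lt] at h1
    set x : ℝ := n + 1 with hx
    have hx1 : 1 ≤ x := by have : (0 : ℝ) ≤ n := n.cast_nonneg; linarith
    have h2 : ε ^ 2 * 2 ^ (n + 1) ≤ 8 * x := by rw [pow_succ (2 : ℝ) n]; linarith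
    have h3 : Real.log (ε ^ 2 * 2 ^ (n + 1)) ≤ Real.log (8 * x) :=
      Real.log_le_log (by positivity) h2
    -- Writing `8 x = 2 ^ 5 * (x / 4)` gives `log (x / 4) ≤ x / 4 - 1`, whose slope `1 / 4` is below
    -- `log 2`, so `x` can be solved for.
    rw [Real.log_mul (by positivity) (by positivity), Real.log_pow, Real.log_pow,
      show 8 * x = 2 ^ 5 * (x / 4) by ring, Real.log_mul (by positivity) (by positivity),
      Real.log_pow] at h3
    have h4 := Real.log_le_sub_one_of_pos (show 0 < x / 4 by positivity)
    have h5 := Real.log_two_gt_d9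
    have h6 := Real.log_two_lt_d9
    push_cast at h3
    rw [← hx] at h3
    have h7 : x ≤ 6 + 5 * Real.log (1 / ε) := by
      rw [hL] at hL0 ⊢
      nlinarith
    rw [le_div_iff₀ (by positivity)]
    linarith

/-- The additive part `8 log 2 + 1 ≤ 7` is absorbed through `1 ≤ log (1 / δ) / log (1 / κ)`; this is
where `K` comes to depend on `κ`. -/
lemma roundSupergroups_zero_le {δ κ : ℝ} (hδ : 0 < δ) (hδκ : δ ≤ κ) (hκ1 : κ < 1) :
    (roundSupergroups δ 0 : ℝ) ≤ (7 / Real.log (1 / κ) + 8) * Real.log (1 / δ) := by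
  have hκ : 0 < κ := hδ.trans_le hδκ
  have hL0 : 0 < Real.log (1 / κ) := Real.log_pos (by rw [lt_div_iff₀ hκ]; linarith)
  have hle : Real.log (1 / κ) ≤ Real.log (1 / δ) :=
    Real.log_le_log (by positivity) (one_div_le_one_div_of_le hδ hδκ)
  have hlog := log_one_div_failProb hδ 0
  have h0 : 0 ≤ 8 * Real.log (1 / failProb δ 0) := by
    rw [hlog]; have := Real.log_two_gt_d9; push_cast; linarith
  have h1 : (roundSupergroups δ 0 : ℝ) < 8 * Real.log (1 / failProb δ 0) + 1 :=
    Nat.ceil_lt_add_one h0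
  rw [hlog] at h1
  have h2 : 1 ≤ Real.log (1 / δ) / Real.log (1 / κ) := (one_le_div hL0).2 hle
  have h3 := Real.log_two_lt_d9
  push_cast at h1
  calc (roundSupergroups δ 0 : ℝ) ≤ 7 * 1 + 8 * Real.log (1 / δ) := by linarith
    _ ≤ 7 * (Real.log (1 / δ) / Real.log (1 / κ)) + 8 * Real.log (1 / δ) := by gcongr
    _ = _ := by ring

lemma one_le_exp_ratio {α : ℝ} (hα : 0 < α) : 1 ≤ (Real.exp α + 1) / (Real.exp α - 1) := by
  have := Real.add_one_lt_exp hα.ne'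
  rw [le_div_iff₀ (by linarith)]
  linarith

/-- Here the additive part is `12 log 2 + 1 ≤ 10`, after the rounding error 1 is bounded by the
squared exponential ratio. -/
lemma numSalts_le {α β κ : ℝ} (hα : 0 < α) (hβ : 0 < β) (hβκ : β ≤ κ) (hκ1 : κ < 1) :
    (numSalts α β : ℝ) ≤ ((Real.exp α + 1) / (Real.exp α - 1)) ^ 2 *
      ((10 / Real.log (1 / κ) + 6) * Real.log (1 / β)) := by
  have hκ : 0 < κ := hβ.trans_le hβκ
  have hL0 : 0 < Real.log (1 / κ) := Real.log_pos (by rw [lt_div_iff₀ hκ]; linarith)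
  have hle : Real.log (1 / κ) ≤ Real.log (1 / β) :=
    Real.log_le_log (by positivity) (one_div_le_one_div_of_le hβ hβκ)
  set E := (Real.exp α + 1) / (Real.exp α - 1)
  have hE : 1 ≤ E := one_le_exp_ratio hα
  have hE2 : 1 ≤ E ^ 2 := one_le_pow₀ hE
  have hlog : Real.log (4 / β) = 2 * Real.log 2 + Real.log (1 / β) := by
    rw [show 4 / β = 2 ^ 2 * (1 / β) by ring, Real.log_mul (by norm_num) (by positivity),
      Real.log_pow]
    push_cast; ring
  have h2 := Real.log_two_gt_d9
  have h3 := Real.log_two_lt_d9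
  have h0 : 0 ≤ 6 * E ^ 2 * Real.log (4 / β) := by
    rw [hlog]; have : 0 < Real.log (1 / β) := hL0.trans_le hle; positivity
  have h1 : (numSalts α β : ℝ) ≤ 6 * E ^ 2 * Real.log (4 / β) + 1 := by
    unfold numSalts
    rw [Nat.cast_max]
    refine max_le (by simpa using h0) (Nat.ceil_lt_add_one h0).le
  have h4 : 1 ≤ Real.log (1 / β) / Real.log (1 / κ) := (one_le_div hL0).2 hle
  calc (numSalts α β : ℝ) ≤ 6 * E ^ 2 * Real.log (4 / β) + E ^ 2 := by linarith
    _ = E ^ 2 * (6 * Real.log (4 / β) + 1) := by ring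
    _ ≤ E ^ 2 * (10 * 1 + 6 * Real.log (1 / β)) := by
        refine mul_le_mul_of_nonneg_left ?_ (by positivity)
        rw [hlog]; linarith
    _ ≤ E ^ 2 * (10 * (Real.log (1 / β) / Real.log (1 / κ)) + 6 * Real.log (1 / β)) := by gcongr
    _ = _ := by ring

/-- The numerator is at most `e + 1 ≤ 4`, the denominator at least `α`. -/
lemma exp_ratio_sq_le {α : ℝ} (hα : 0 < α) (hα1 : α ≤ 1) :
    ((Real.exp α + 1) / (Real.exp α - 1)) ^ 2 ≤ 16 / α ^ 2 := by
  have h1 := Real.add_one_lt_exp hα.ne'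
  have h2 : Real.exp α ≤ Real.exp 1 := Real.exp_le_exp.2 hα1
  have h3 := Real.exp_one_lt_d9
  calc _ ≤ (4 / α) ^ 2 := by
        refine pow_le_pow_left₀ (div_nonneg (by linarith) (by linarith)) ?_ 2
        exact div_le_div₀ (by norm_num) (by linarith) hα (by linarith)
    _ = _ := by ring

/-- Under the alternative the tester rejects after few samples, with probability at least
`1 - δ`. -/
lemma exists_sample_bound {κ : ℝ} (hκ : 0 < κ) (hκ1 : κ < 1) : ∃ K : ℝ, 0 < K ∧
    ∀ (k : ℕ) (p : PMF (Fin k)) (c₀ α β δ ε B : ℝ),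
      0 < α → 0 < β → β ≤ κ → 0 < δ → δ ≤ κ → 0 < ε → ε ≤ κ → ε ≤ |collisionProb p - c₀| →
      K * (((Real.exp α + 1) / (Real.exp α - 1)) ^ 2 *
        (Real.log (1 / ε) ^ 2 * Real.log (1 / β) * Real.log (1 / δ) / ε ^ 2)) ≤ B →
      ENNReal.ofReal (1 - δ) ≤ fullLaw p α β δ {ω | RejectsWithin c₀ α β δ B ω.2 ω.1} := by
  set L₀ := Real.log (1 / κ) with hL₀def
  have hL₀ : 0 < L₀ := Real.log_pos (by rw [lt_div_iff₀ hκ]; linarith)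
  refine ⟨1280 * (7 / L₀ + 8) * (10 / L₀ + 6) * (8 * (6 / L₀ ^ 2 + 5 / L₀)), by positivity, ?_⟩
  intro k p c₀ α β δ ε B hα hβ hβκ hδ hδκ hε hεκ h hB
  obtain ⟨T, hT1, hT2⟩ := exists_round hε (hεκ.trans_lt hκ1)
  refine rejectsWithin_of_round p hδ (hδκ.trans hκ1.le) hε h hT1 (le_trans ?_ hB)
  have mono : ∀ y, 0 < y → y ≤ κ → L₀ ≤ Real.log (1 / y) := fun y hy hyκ =>
    Real.log_le_log (by positivity) (one_div_le_one_div_of_le hy hyκ)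
  have hε' := mono ε hε hεκ
  have hβ' := hL₀.trans_le (mono β hβ hβκ)
  have hδ' := hL₀.trans_le (mono δ hδ hδκ)
  have h1 : 1 ≤ Real.log (1 / ε) / L₀ := (one_le_div hL₀).2 hε'
  -- Lower powers of the logarithm are raised to the square by factors `log (1 / ε) / L₀ ≥ 1`.
  have h2 : 6 + 5 * Real.log (1 / ε) ≤ (6 / L₀ ^ 2 + 5 / L₀) * Real.log (1 / ε) ^ 2 := by
    have hpos : 0 < Real.log (1 / ε) := hL₀.trans_le hε'
    calc 6 + 5 * Real.log (1 / ε) = 6 * 1 ^ 2 + 5 * (1 * Real.log (1 / ε)) := by ring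
      _ ≤ 6 * (Real.log (1 / ε) / L₀) ^ 2
          + 5 * (Real.log (1 / ε) / L₀ * Real.log (1 / ε)) := by gcongr
      _ = _ := by field_simp
  have h3 : (2 : ℝ) ^ T ≤ 8 * ((6 / L₀ ^ 2 + 5 / L₀) * Real.log (1 / ε) ^ 2) / ε ^ 2 :=
    hT2.trans (by gcongr)
  have ha := roundSupergroups_zero_le hδ hδκ hκ1
  have hr := numSalts_le hα hβ hβκ hκ1
  rw [← hL₀def] at ha hr
  set E := (Real.exp α + 1) / (Real.exp α - 1)
  calc _ ≤ 1280 * ((7 / L₀ + 8) * Real.log (1 / δ)) *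
        (E ^ 2 * ((10 / L₀ + 6) * Real.log (1 / β))) *
        (8 * ((6 / L₀ ^ 2 + 5 / L₀) * Real.log (1 / ε) ^ 2) / ε ^ 2) := by gcongr
    _ = _ := by ring

end SampleBound

/-! ### Measurability of the transcript. -/

section Measurability

variable {r k : ℕ}

/-- The sum of the hash values of group `j` as an integer. -/
def intGroupSum (T : RunTranscript r k) (j : ℕ) : ℤ :=
  ∑ i ∈ Finset.range (T.1 j), (T.2.2 (j, i) : ℤ)

lemma measurable_intGroupSum (j : ℕ) : Measurable fun T : RunTranscript r k => intGroupSum T j := by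
  have h : ∀ n, Measurable fun T : RunTranscript r k =>
      ∑ i ∈ Finset.range n, (T.2.2 (j, i) : ℤ) := fun n =>
    Finset.measurable_fun_sum _ fun i _ =>
      (Measurable.of_discrete (f := fun u : ℤˣ => (u : ℤ))).comp
        ((measurable_pi_apply (j, i)).comp (measurable_snd.comp measurable_snd))
  exact measurable_eval_at (f := fun (T : RunTranscript r k) n =>
    ∑ i ∈ Finset.range n, (T.2.2 (j, i) : ℤ)) (by fun_prop) (by fun_prop)

/-- The estimate factors through finitely many integer group sums, and every function on the
countable discrete space `Fin (a * b) → ℤ` is measurable; so sorting needs no analysis. -/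
lemma measurable_estimate (a b : ℕ) (m : ℝ) :
    Measurable (estimate a b m : RunTranscript r k → ℝ) := by
  have h : (estimate a b m : RunTranscript r k → ℝ) = (fun v : Fin (a * b) → ℤ =>
      median a fun l => (1 / (b : ℝ)) * ∑ j ∈ Finset.range b,
        (r * (((if h : l * b + j < a * b then v ⟨l * b + j, h⟩ else 0 : ℤ) : ℝ) ^ 2 - m) / m ^ 2)) ∘
      fun T j => intGroupSum T j := by
    ext T
    refine median_congr fun l hl => ?_
    congr 1
    refine Finset.sum_congr rfl fun j hj => ?_
    have hlt : l * b + j < a * b := by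
      have h1 : (l + 1) * b ≤ a * b := Nat.mul_le_mul_right _ hl
      have := Finset.mem_range.1 hj
      rw [add_mul] at h1; omega
    rw [dif_pos hlt]
    simp [groupEstimate, groupSum, intGroupSum]
  rw [h]
  exact Measurable.of_discrete.comp (measurable_pi_lambda _ fun j => measurable_intGroupSum _)

/-- The tester is stopped before round `t`, in terms of the transcripts of the rounds. -/
def StoppedBefore (c₀ α β δ : ℝ) (R : ℕ → RunTranscript (numSalts α β) k) (t : ℕ) : Prop :=
  ∃ u < t, radius α β δ u < |estimate (roundSupergroups δ u) (roundGroupsPer α β δ u)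
    (roundRate α β δ u) (R u) - c₀| ∧ ∀ v < u, ¬ radius α β δ v <
      |estimate (roundSupergroups δ v) (roundGroupsPer α β δ v) (roundRate α β δ v) (R v) - c₀|

open Classical in
/-- The transcript of the tester, in terms of the transcripts of the rounds. -/
noncomputable def stoppedTranscript (c₀ α β δ : ℝ) (R : ℕ → RunTranscript (numSalts α β) k) :
    ℕ → Unit ⊕ RunTranscript (numSalts α β) k :=
  fun t => if StoppedBefore c₀ α β δ R t then Sum.inl () else Sum.inr (R t)

/-- Stopping is post-processing of the transcripts of all rounds, run or not. Measurability and
privacy therefore reduce to `roundTranscript`. -/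
lemma transcript_eq_stoppedTranscript (c₀ α β δ : ℝ) (x : ℕ → Fin k)
    (ω : Seed (numSalts α β) k) :
    transcript c₀ α β δ x ω = stoppedTranscript c₀ α β δ (roundTranscript α β δ x ω) := by
  ext1 t
  have hiff : (∃ u < t, RejectsAt c₀ α β δ x ω u) ↔
    StoppedBefore c₀ α β δ (roundTranscript α β δ x ω) t := Iff.rfl
  unfold transcript stoppedTranscript
  by_cases h : StoppedBefore c₀ α β δ (roundTranscript α β δ x ω) t
  · rw [if_pos h, if_pos (hiff.2 h)]
  · rw [if_neg h, if_neg (mt hiff.1 h)]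

lemma measurable_stoppedTranscript (c₀ α β δ : ℝ) :
    Measurable (stoppedTranscript (k := k) c₀ α β δ) := by
  classical
  have hE : ∀ u, MeasurableSet {R : ℕ → RunTranscript (numSalts α β) k | radius α β δ u <
      |estimate (roundSupergroups δ u) (roundGroupsPer α β δ u) (roundRate α β δ u) (R u) - c₀|} :=
    fun u => by
      have := (measurable_estimate (r := numSalts α β) (k := k) (roundSupergroups δ u)
        (roundGroupsPer α β δ u) (roundRate α β δ u)).comp
          (measurable_pi_apply (X := fun _ : ℕ => RunTranscript (numSalts α β) k) u)
      exact measurableSet_lt measurable_const (this.sub_const c₀).abs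
  refine measurable_pi_lambda _ fun t => Measurable.ite ?_ measurable_const
    (measurable_inr.comp (measurable_pi_apply t))
  have : {R : ℕ → RunTranscript (numSalts α β) k | StoppedBefore c₀ α β δ R t} =
      ⋃ u, ⋃ _ : u < t, ({R : ℕ → RunTranscript (numSalts α β) k | radius α β δ u <
      |estimate (roundSupergroups δ u) (roundGroupsPer α β δ u) (roundRate α β δ u) (R u) - c₀|} ∩
      ⋂ v, ⋂ _ : v < u, {R : ℕ → RunTranscript (numSalts α β) k | radius α β δ v <
      |estimate (roundSupergroups δ v) (roundGroupsPer α β δ v) (roundRate α β δ v) (R v)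
        - c₀|}ᶜ) := by
    ext R
    simp only [StoppedBefore, Set.mem_ofPred_eq, Set.mem_iUnion, Set.mem_inter_iff, Set.mem_iInter,
      Set.mem_compl_iff, exists_prop]
  rw [this]
  exact .iUnion fun u => .iUnion fun _ => (hE u).inter (.iInter fun v => .iInter fun _ => (hE v).compl)

lemma measurable_roundTranscript (α β δ : ℝ) (x : ℕ → Fin k) (t : ℕ) :
    Measurable fun ω : Seed (numSalts α β) k => roundTranscript α β δ x ω t := by
  have hN : Measurable fun (ω : Seed (numSalts α β) k) (j : ℕ) => ω.1 (t, j) := by fun_prop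
  have hh : Measurable fun (ω : Seed (numSalts α β) k) (q : ℕ × Fin (numSalts α β) × Fin k) =>
    ω.2.1 (t, q) := by fun_prop
  unfold roundTranscript runTranscript
  refine Measurable.prodMk ?_ (hh.prodMk ?_)
  · refine measurable_pi_lambda _ fun j => ?_
    split_ifs
    · fun_prop
    · exact measurable_const
  · refine measurable_pi_lambda _ fun q => ?_
    have hu : Measurable fun ω : Seed (numSalts α β) k =>
        usersBefore α β δ ω t + member (fun j => ω.1 (t, j)) q.1 q.2 :=
      (measurable_usersBefore α β δ t).add (measurable_member _ _ hN)
    have hx : Measurable x := measurable_from_top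
    refine Measurable.ite ?_ ?_ measurable_const
    · by_cases hq : q.1 < roundGroups α β δ t
      · simp only [hq, true_and]
        exact measurableSet_lt measurable_const (by fun_prop)
      · simp [hq]
    · exact measurable_eval_at hh (measurable_const.prodMk
        ((measurable_eval_at (f := fun (ω : Seed (numSalts α β) k) => ω.2.2) (by fun_prop) hu).prodMk
          (hx.comp hu)))

lemma measurable_transcript (c₀ α β δ : ℝ) (x : ℕ → Fin k) :
    Measurable fun ω : Seed (numSalts α β) k => transcript c₀ α β δ x ω := by
  simp_rw [transcript_eq_stoppedTranscript]
  exact (measurable_stoppedTranscript c₀ α β δ).comp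
    (measurable_pi_lambda _ fun t => measurable_roundTranscript α β δ x t)

end Measurability

/-! ### The position of a user, and what the transcript reveals about that user. -/

section Positions

variable {k : ℕ}

/-- The number of users who take part in the rounds before round `t`, in terms of the group
sizes. -/
noncomputable def firstUser (α β δ : ℝ) (N : ℕ × ℕ → ℕ) (t : ℕ) : ℕ :=
  ∑ u ∈ Finset.range t, ∑ j ∈ Finset.range (roundGroups α β δ u), N (u, j)

/-- User `i` is a member of group `j` in round `t`. -/
def IsMember (α β δ : ℝ) (N : ℕ × ℕ → ℕ) (i t j : ℕ) : Prop :=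
  j < roundGroups α β δ t ∧
    ∃ l < N (t, j), firstUser α β δ N t + member (fun j => N (t, j)) j l = i

lemma IsMember.lt_firstUser {α β δ : ℝ} {N : ℕ × ℕ → ℕ} {i t t' j : ℕ}
    (h : IsMember α β δ N i t j) (ht : t < t') : i < firstUser α β δ N t' := by
  obtain ⟨hj, l, hl, rfl⟩ := h
  have h1 : firstUser α β δ N (t + 1) ≤ firstUser α β δ N t' :=
    Finset.sum_le_sum_of_subset (Finset.range_subset_range.2 ht)
  have h2 : ∑ j' ∈ Finset.range (j + 1), N (t, j') ≤
      ∑ j' ∈ Finset.range (roundGroups α β δ t), N (t, j') :=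
    Finset.sum_le_sum_of_subset (Finset.range_subset_range.2 hj)
  rw [firstUser, Finset.sum_range_succ, ← firstUser] at h1
  rw [Finset.sum_range_succ] at h2
  simp only [member]
  omega

/-- Each user takes part in at most one group of one round. -/
lemma IsMember.unique {α β δ : ℝ} {N : ℕ × ℕ → ℕ} {i t j t' j' : ℕ}
    (h : IsMember α β δ N i t j) (h' : IsMember α β δ N i t' j') : t = t' ∧ j = j' := by
  have key : ∀ {t j t' j'}, IsMember α β δ N i t j → IsMember α β δ N i t' j' → ¬ t < t' := by
    intro t j t' j' h h' hlt
    have h1 := h.lt_firstUser hlt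
    obtain ⟨_, l, _, rfl⟩ := h'
    omega
  obtain rfl : t = t' := le_antisymm (not_lt.1 (key h' h)) (not_lt.1 (key h h'))
  obtain ⟨_, l, hl, h1⟩ := h
  obtain ⟨_, l', hl', h2⟩ := h'
  exact ⟨rfl, (member_inj _ hl hl' (Nat.add_left_cancel (h1.trans h2.symm))).1⟩

/-- The transcript depends on the salt and the sample of user `i` only through the hash value
which this user sends. -/
lemma transcript_congr (c₀ α β δ : ℝ) {x x' : ℕ → Fin k} {N : ℕ × ℕ → ℕ}
    {h : ℕ × ℕ × Fin (numSalts α β) × Fin k → ℤˣ} {s s' : ℕ → Fin (numSalts α β)} (i : ℕ)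
    (hx : ∀ u, u ≠ i → x u = x' u) (hs : ∀ u, u ≠ i → s u = s' u)
    (hi : ∀ t j, IsMember α β δ N i t j → h (t, j, s i, x i) = h (t, j, s' i, x' i)) :
    transcript c₀ α β δ x (N, h, s) = transcript c₀ α β δ x' (N, h, s') := by
  rw [transcript_eq_stoppedTranscript, transcript_eq_stoppedTranscript]
  congr 1
  ext1 t
  unfold roundTranscript runTranscript
  refine Prod.ext rfl (Prod.ext rfl (funext fun q => ?_))
  simp only
  split_ifs with hq
  · change h (t, q.1, s (firstUser α β δ N t + _), x (firstUser α β δ N t + _)) =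
      h (t, q.1, s' (firstUser α β δ N t + _), x' (firstUser α β δ N t + _))
    by_cases hu : firstUser α β δ N t + member (fun j => N (t, j)) q.1 q.2 = i
    · rw [hu]
      exact hi t q.1 ⟨hq.1, q.2, hq.2, hu⟩
    · rw [hx _ hu, hs _ hu]
  · rfl

end Positions

/-! ### Balanced hash functions as local randomizers. -/

section Randomizer

/-- The probability that the hash value of a uniformly salted sample lies in `E`. -/
lemma uniformOn_hash_mem {r : ℕ} [NeZero r] (f : Fin r → ℤˣ) (E : Set ℤˣ) :
    (uniformOn (Set.univ : Set (Fin r))) {v | f v ∈ E} = ENNReal.ofReal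
      ((E.indicator 1 1 * (r + ∑ v, ((f v : ℤ) : ℝ)) +
        E.indicator 1 (-1) * (r - ∑ v, ((f v : ℤ) : ℝ))) / (2 * r)) := by
  classical
  have hr : (r : ℝ) ≠ 0 := by exact_mod_cast NeZero.ne r
  rw [← ENNReal.ofReal_toReal (measure_ne_top (uniformOn (Set.univ : Set (Fin r))) {v | f v ∈ E})]
  congr 1
  have h1 : (uniformOn (Set.univ : Set (Fin r))).real {v | f v ∈ E} =
      (∑ v, E.indicator (1 : ℤˣ → ℝ) (f v)) / r := by
    rw [Measure.real, uniformOn_univ, Measure.count_apply .of_discrete, ENNReal.toReal_div]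
    congr 1
    · rw [show {v | f v ∈ E} = ((Finset.univ.filter fun v => f v ∈ E : Finset (Fin r)) : Set (Fin r))
        by ext; simp, Set.encard_coe_eq_coe_finsetCard, Finset.card_filter]
      simp [Set.indicator_apply]
    · simp
  rw [← Measure.real, h1]
  have h2 : ∀ v, E.indicator (1 : ℤˣ → ℝ) (f v) = E.indicator 1 1 * ((1 + ((f v : ℤ) : ℝ)) / 2) +
      E.indicator 1 (-1) * ((1 - ((f v : ℤ) : ℝ)) / 2) := fun v => by
    rcases Int.units_eq_one_or (f v) with hv | hv <;> rw [hv] <;> norm_num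
  simp_rw [h2]
  rw [Finset.sum_add_distrib, ← Finset.mul_sum, ← Finset.mul_sum, ← Finset.sum_div,
    ← Finset.sum_div, Finset.sum_add_distrib, Finset.sum_sub_distrib]
  simp only [Finset.sum_const, Finset.card_univ, Fintype.card_fin, nsmul_eq_mul, mul_one]
  field_simp

/-- A balanced hash function is a good local randomizer. -/
lemma uniformOn_hash_mem_le {r : ℕ} [NeZero r] {α : ℝ} (f f' : Fin r → ℤˣ)
    (hf : |∑ v, ((f v : ℤ) : ℝ)| ≤ (Real.exp α - 1) / (Real.exp α + 1) * r)
    (hf' : |∑ v, ((f' v : ℤ) : ℝ)| ≤ (Real.exp α - 1) / (Real.exp α + 1) * r) (E : Set ℤˣ) :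
    (uniformOn (Set.univ : Set (Fin r))) {v | f v ∈ E} ≤
      ENNReal.ofReal (Real.exp α) * (uniformOn (Set.univ : Set (Fin r))) {v | f' v ∈ E} := by
  have hr : (0 : ℝ) < r := by exact_mod_cast Nat.pos_of_ne_zero (NeZero.ne r)
  have hexp : 0 < Real.exp α := Real.exp_pos α
  rw [uniformOn_hash_mem, uniformOn_hash_mem, ← ENNReal.ofReal_mul hexp.le]
  refine ENNReal.ofReal_le_ofReal ?_
  rw [← mul_div_assoc]
  refine div_le_div_of_nonneg_right ?_ (by positivity)
  set S := ∑ v, ((f v : ℤ) : ℝ)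
  set S' := ∑ v, ((f' v : ℤ) : ℝ)
  set τ := (Real.exp α - 1) / (Real.exp α + 1) with hτ
  -- This identity is what determines `τ`: the extreme sign probabilities have ratio exactly `exp
  -- α`.
  have hτe : Real.exp α * (1 - τ) = 1 + τ := by rw [hτ]; field_simp; ring
  obtain ⟨a1, a2⟩ := abs_le.1 hf
  obtain ⟨b1, b2⟩ := abs_le.1 hf'
  have e : Real.exp α * (r - τ * r) = r + τ * r := by linear_combination r * hτe
  have c1 : r + S ≤ Real.exp α * (r + S') := by
    have : Real.exp α * (r - τ * r) ≤ Real.exp α * (r + S') :=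
      mul_le_mul_of_nonneg_left (by linarith) hexp.le
    linarith
  have c2 : r - S ≤ Real.exp α * (r - S') := by
    have : Real.exp α * (r - τ * r) ≤ Real.exp α * (r - S') :=
      mul_le_mul_of_nonneg_left (by linarith) hexp.le
    linarith
  have i1 : (0 : ℝ) ≤ E.indicator 1 (1 : ℤˣ) := Set.indicator_nonneg (fun _ _ => zero_le_one) _
  have i2 : (0 : ℝ) ≤ E.indicator 1 (-1 : ℤˣ) := Set.indicator_nonneg (fun _ _ => zero_le_one) _
  have := mul_le_mul_of_nonneg_left c1 i1
  have := mul_le_mul_of_nonneg_left c2 i2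
  linarith

/-- A random hash function is balanced with high probability. -/
lemma measure_unbalanced_le {k : ℕ} {α β : ℝ} (hα : 0 < α) (hβ : 0 < β) (hβ1 : β ≤ 1)
    (t j : ℕ) (y : Fin k) :
    (Measure.infinitePi fun _ : ℕ × ℕ × Fin (numSalts α β) × Fin k =>
      uniformOn (Set.univ : Set ℤˣ)) {h | (Real.exp α - 1) / (Real.exp α + 1) * numSalts α β <
        |∑ v, ((h (t, j, v, y) : ℤ) : ℝ)|} ≤ ENNReal.ofReal (β / 2) := by
  set P := Measure.infinitePi fun _ : ℕ × ℕ × Fin (numSalts α β) × Fin k =>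
      uniformOn (Set.univ : Set ℤˣ) with hP
  set τ := (Real.exp α - 1) / (Real.exp α + 1) with hτ
  have hexp : 1 < Real.exp α := Real.one_lt_exp_iff.2 hα
  have hτ0 : 0 < τ := div_pos (by linarith) (by linarith)
  have hr1 := one_le_numSalts α β
  have hg : ∀ σ : ℝ, Measurable fun u : ℤˣ => σ * ((u : ℤ) : ℝ) := fun σ => .of_discrete
  have tail : ∀ σ : ℝ, σ = 1 ∨ σ = -1 →
      P.real {h | τ * numSalts α β ≤ ∑ v, σ * ((h (t, j, v, y) : ℤ) : ℝ)} ≤ β / 4 := by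
    intro σ hσ
    have hind : iIndepFun (fun (v : Fin (numSalts α β))
        (h : ℕ × ℕ × Fin (numSalts α β) × Fin k → ℤˣ) => σ * ((h (t, j, v, y) : ℤ) : ℝ)) P := by
      have := iIndepFun_infinitePi (P := fun _ : ℕ × ℕ × Fin (numSalts α β) × Fin k =>
        uniformOn (Set.univ : Set ℤˣ)) (X := fun _ u => σ * ((u : ℤ) : ℝ)) (fun _ => hg σ)
      exact this.precomp (g := fun v : Fin (numSalts α β) => (t, j, v, y))
        fun v v' hv => by simpa using hv
    have hsub : ∀ v ∈ Finset.univ, HasSubgaussianMGF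
        (fun h : ℕ × ℕ × Fin (numSalts α β) × Fin k → ℤˣ => σ * ((h (t, j, v, y) : ℤ) : ℝ))
        ((‖(1 : ℝ) - (-1)‖₊ / 2) ^ 2) P := by
      intro v _
      refine hasSubgaussianMGF_of_mem_Icc_of_integral_eq_zero
        ((hg σ).comp (measurable_pi_apply _)).aemeasurable (ae_of_all _ fun h => ?_) ?_
      · rcases hσ with rfl | rfl <;>
          rcases Int.units_eq_one_or (h (t, j, v, y)) with hu | hu <;> rw [hu] <;> norm_num
      · have := integral_map (μ := P) (measurable_pi_apply (t, j, v, y)).aemeasurable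
          (f := fun u : ℤˣ => σ * ((u : ℤ) : ℝ)) (hg σ).aestronglyMeasurable
        rw [← this, hP, Measure.infinitePi_map_eval, integral_uniformOn_sign]
        simp
    have key := HasSubgaussianMGF.measure_sum_ge_le_of_iIndepFun hind hsub
      (ε := τ * numSalts α β) (by positivity)
    refine key.trans ?_
    have hc : (((∑ _v : Fin (numSalts α β), (‖(1 : ℝ) - (-1)‖₊ / 2) ^ 2 : NNReal)) : ℝ) =
        numSalts α β := by
      norm_num
    rw [hc]
    have hE : -(τ * numSalts α β) ^ 2 / (2 * (numSalts α β : ℝ)) = -(τ ^ 2 * numSalts α β / 2) := by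
      field_simp
    rw [hE]
    have hrge : 6 * ((Real.exp α + 1) / (Real.exp α - 1)) ^ 2 * Real.log (4 / β) ≤
        numSalts α β := by
      refine (Nat.le_ceil _).trans ?_
      exact_mod_cast le_max_right _ _
    have hτinv : (Real.exp α + 1) / (Real.exp α - 1) = τ⁻¹ := by rw [hτ, inv_div]
    rw [hτinv] at hrge
    have h3 : 6 * Real.log (4 / β) ≤ τ ^ 2 * numSalts α β := by
      have := mul_le_mul_of_nonneg_left hrge (sq_nonneg τ)
      refine le_trans (le_of_eq ?_) this
      field_simp
    have hlog : 0 ≤ Real.log (4 / β) := Real.log_nonneg (by rw [le_div_iff₀ hβ]; linarith)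
    -- The tail is at most `(β / 4) ^ 3`, as the 6 in the number of salts exceeds the 2 that is
    -- needed. Two tails give `β / 2`.
    rw [← Real.le_log_iff_exp_le (by positivity), ← inv_div 4 β, Real.log_inv]
    linarith
  have t1 := tail 1 (Or.inl rfl)
  have t2 := tail (-1) (Or.inr rfl)
  rw [← ENNReal.ofReal_toReal (measure_ne_top P _)]
  refine ENNReal.ofReal_le_ofReal ?_
  refine (measureReal_mono (s₂ := {h | τ * numSalts α β ≤ ∑ v, 1 * ((h (t, j, v, y) : ℤ) : ℝ)} ∪
    {h | τ * numSalts α β ≤ ∑ v, -1 * ((h (t, j, v, y) : ℤ) : ℝ)}) ?_).trans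
    ((measureReal_union_le _ _).trans (by linarith))
  intro h hh
  simp only [Set.mem_ofPred_eq, Set.mem_union, one_mul, ← Finset.mul_sum] at hh ⊢
  rcases lt_abs.1 hh with h1 | h1
  · exact Or.inl h1.le
  · right; linarith

end Randomizer

/-! ### Local differential privacy. -/

section Privacy

variable {k : ℕ} {c₀ α β δ : ℝ}

/-- For a balanced hash function, the transcript is private with respect to the salts. -/
lemma measure_salts_le {x x' : ℕ → Fin k} (i : ℕ) (hx : ∀ j, j ≠ i → x' j = x j)
    {O : Set (ℕ → Unit ⊕ RunTranscript (numSalts α β) k)} (hO : MeasurableSet O)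
    {N : ℕ × ℕ → ℕ} {h : ℕ × ℕ × Fin (numSalts α β) × Fin k → ℤˣ} {t j : ℕ}
    (htj : ∀ t' j', IsMember α β δ N i t' j' → t' = t ∧ j' = j)
    (hb : |∑ v, ((h (t, j, v, x i) : ℤ) : ℝ)| ≤
      (Real.exp α - 1) / (Real.exp α + 1) * numSalts α β)
    (hb' : |∑ v, ((h (t, j, v, x' i) : ℤ) : ℝ)| ≤
      (Real.exp α - 1) / (Real.exp α + 1) * numSalts α β) :
    (Measure.infinitePi fun _ : ℕ => uniformOn (Set.univ : Set (Fin (numSalts α β))))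
      {s | transcript c₀ α β δ x (N, h, s) ∈ O} ≤ ENNReal.ofReal (Real.exp α) *
    (Measure.infinitePi fun _ : ℕ => uniformOn (Set.univ : Set (Fin (numSalts α β))))
      {s | transcript c₀ α β δ x' (N, h, s) ∈ O} := by
  have hmeas : ∀ x : ℕ → Fin k, MeasurableSet {s | transcript c₀ α β δ x (N, h, s) ∈ O} := fun x =>
    ((measurable_transcript c₀ α β δ x).comp
      (by fun_prop : Measurable fun s : ℕ → Fin (numSalts α β) => (N, h, s))) hO
  have hupd : Measurable fun z : (ℕ → Fin (numSalts α β)) × Fin (numSalts α β) =>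
      Function.update z.1 i z.2 := by
    refine measurable_pi_lambda _ fun j => ?_
    by_cases h : j = i
    · subst h; simpa using measurable_snd
    · simp only [Function.update_of_ne h]; fun_prop
  rw [← infinitePi_map_update (uniformOn (Set.univ : Set (Fin (numSalts α β)))) i,
    Measure.map_apply hupd (hmeas x), Measure.map_apply hupd (hmeas x'),
    Measure.prod_apply (hupd (hmeas x)), Measure.prod_apply (hupd (hmeas x')),
    ← lintegral_const_mul' _ _ ENNReal.ofReal_ne_top]
  refine lintegral_mono fun s => ?_
  -- The signs of user `i` that lead into `O`, the other salts being fixed. Quantifying over the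
  -- sample `z` too makes one set `E` serve both `x` and `x'`.
  set E : Set ℤˣ := {e | ∃ v z, h (t, j, v, z) = e ∧
    transcript c₀ α β δ (Function.update x i z) (N, h, Function.update s i v) ∈ O} with hE
  have hiff : ∀ z v, transcript c₀ α β δ (Function.update x i z) (N, h, Function.update s i v) ∈ O ↔
      h (t, j, v, z) ∈ E := by
    refine fun z v => ⟨fun hv => ⟨v, z, rfl, hv⟩, ?_⟩
    rintro ⟨v', z', h1, h2⟩
    rw [transcript_congr c₀ α β δ (x' := Function.update x i z') (s' := Function.update s i v') i]
    · exact h2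
    · intro u hu; simp [Function.update_of_ne hu]
    · intro u hu; simp [Function.update_of_ne hu]
    · intro t' j' hm
      obtain ⟨rfl, rfl⟩ := htj t' j' hm
      simp [h1]
  have hx' : x' = Function.update x i (x' i) := by
    ext1 u
    by_cases hu : u = i
    · subst hu; simp
    · rw [Function.update_of_ne hu, hx u hu]
  have e1 : Prod.mk s ⁻¹' ((fun z : (ℕ → Fin (numSalts α β)) × Fin (numSalts α β) =>
      Function.update z.1 i z.2) ⁻¹' {s | transcript c₀ α β δ x (N, h, s) ∈ O}) =
      {v | h (t, j, v, x i) ∈ E} := by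
    ext v
    rw [Set.mem_ofPred_eq, ← hiff, Function.update_eq_self]
    rfl
  have e2 : Prod.mk s ⁻¹' ((fun z : (ℕ → Fin (numSalts α β)) × Fin (numSalts α β) =>
      Function.update z.1 i z.2) ⁻¹' {s | transcript c₀ α β δ x' (N, h, s) ∈ O}) =
      {v | h (t, j, v, x' i) ∈ E} := by
    ext v
    rw [Set.mem_ofPred_eq, ← hiff, ← hx']
    rfl
  rw [e1, e2]
  exact uniformOn_hash_mem_le _ _ hb hb' E

/-- The tester is locally differentially private. -/
lemma isLDP_transcript (hα : 0 < α) (hβ : 0 < β) (hβ1 : β ≤ 1) :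
    IsLDP α β (seedLaw k α β δ) (fun x ω => transcript c₀ α β δ x ω) := by
  intro i x x' hx O hO
  have hA : ∀ x : ℕ → Fin k, MeasurableSet
      {ω : Seed (numSalts α β) k | transcript c₀ α β δ x ω ∈ O} :=
    fun x => measurable_transcript c₀ α β δ x hO
  unfold seedLaw
  set PN := Measure.infinitePi fun q : ℕ × ℕ => poissonMeasure (roundRate α β δ q.1).toNNReal
  set PH := Measure.infinitePi fun _ : ℕ × ℕ × Fin (numSalts α β) × Fin k =>
    uniformOn (Set.univ : Set ℤˣ)
  set PS := Measure.infinitePi fun _ : ℕ => uniformOn (Set.univ : Set (Fin (numSalts α β)))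
  rw [Measure.prod_apply (hA x), Measure.prod_apply (hA x'),
    ← lintegral_const_mul' _ _ ENNReal.ofReal_ne_top]
  have hconst : ENNReal.ofReal β = ∫⁻ _N : ℕ × ℕ → ℕ, ENNReal.ofReal β ∂PN := by simp
  rw [hconst, ← lintegral_add_right _ measurable_const]
  refine lintegral_mono fun N => ?_
  have hA2 := fun x => measurable_prodMk_left (x := N) (hA x)
  rw [Measure.prod_apply (hA2 x), Measure.prod_apply (hA2 x'),
    ← lintegral_const_mul' _ _ ENNReal.ofReal_ne_top]
  obtain ⟨t, j, htj⟩ : ∃ t j, ∀ t' j', IsMember α β δ N i t' j' → t' = t ∧ j' = j := by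
    by_cases hex : ∃ t j, IsMember α β δ N i t j
    · obtain ⟨t, j, h⟩ := hex
      exact ⟨t, j, fun t' j' h' => h'.unique h⟩
    -- A user who takes part in no group sends nothing, so any pair will do.
    · exact ⟨0, 0, fun t' j' h' => absurd ⟨t', j', h'⟩ hex⟩
  set Bad : Fin k → Set (ℕ × ℕ × Fin (numSalts α β) × Fin k → ℤˣ) := fun y =>
    {h | (Real.exp α - 1) / (Real.exp α + 1) * numSalts α β <
      |∑ v, ((h (t, j, v, y) : ℤ) : ℝ)|} with hBad
  have hBm : ∀ y, MeasurableSet (Bad y) := fun y => by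
    refine measurableSet_lt measurable_const (Measurable.abs (Finset.measurable_fun_sum _ fun v _ => ?_))
    exact (Measurable.of_discrete (f := fun u : ℤˣ => ((u : ℤ) : ℝ))).comp
      (measurable_pi_apply (t, j, v, y))
  have hBP : PH (Bad (x i) ∪ Bad (x' i)) ≤ ENNReal.ofReal β := by
    refine (measure_union_le _ _).trans ((add_le_add (measure_unbalanced_le hα hβ hβ1 t j (x i))
      (measure_unbalanced_le hα hβ hβ1 t j (x' i))).trans (le_of_eq ?_))
    rw [← ENNReal.ofReal_add (by positivity) (by positivity), add_halves]
  have hBu := (hBm (x i)).union (hBm (x' i))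
  calc _ ≤ ∫⁻ h, (ENNReal.ofReal (Real.exp α) *
          PS (Prod.mk h ⁻¹' (Prod.mk N ⁻¹' {ω | transcript c₀ α β δ x' ω ∈ O})) +
          (Bad (x i) ∪ Bad (x' i)).indicator 1 h) ∂PH := by
        refine lintegral_mono fun h => ?_
        -- On unbalanced hash functions the trivial bound 1 is charged to the indicator, whose
        -- integral is at most `β`.
        by_cases hb : h ∈ Bad (x i) ∪ Bad (x' i)
        · simp only [Set.indicator_of_mem hb, Pi.one_apply]
          exact prob_le_one.trans le_add_self
        · refine le_add_right ?_
          rw [Set.mem_union, not_or] at hb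
          simp only [hBad, Set.mem_ofPred_eq, not_lt] at hb
          exact measure_salts_le i hx hO htj hb.1 hb.2
    _ = _ := lintegral_add_right _ (measurable_one.indicator hBu)
    _ ≤ _ := by
        rw [lintegral_indicator_one hBu]
        gcongr

end Privacy

end CollisionTest

/-! ### The main theorem. -/

open CollisionTest in
theorem theorem7 :
    -- local differential privacy
    (∀ (k : ℕ) (c₀ α β δ : ℝ), 0 < α → 0 < β → β ≤ 1 → 0 < δ → δ ≤ 1 →
      IsLDP α β (seedLaw k α β δ) (fun x ω => transcript c₀ α β δ x ω)) ∧
    -- under the null hypothesis the tester never rejects, with probability at least `1 - δ`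
    (∀ (k : ℕ) (p : PMF (Fin k)) (c₀ α β δ : ℝ), 0 < α → 0 < β → β ≤ 1 → 0 < δ → δ ≤ 1 →
      collisionProb p = c₀ →
      ENNReal.ofReal (1 - δ) ≤
        fullLaw p α β δ {ω | ∀ t, ¬ RejectsAt c₀ α β δ ω.2 ω.1 t}) ∧
    -- under the alternative it rejects, and the number of samples is bounded
    (∀ κ : ℝ, 0 < κ → κ < 1 → ∃ K : ℝ, 0 < K ∧
      ∀ (k : ℕ) (p : PMF (Fin k)) (c₀ α β δ ε : ℝ),
        0 < α → 0 < β → β ≤ κ → 0 < δ → δ ≤ κ → 0 < ε → ε ≤ κ →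
        ε ≤ |collisionProb p - c₀| →
        ENNReal.ofReal (1 - δ) ≤ fullLaw p α β δ {ω | RejectsWithin c₀ α β δ
          (K * (((Real.exp α + 1) / (Real.exp α - 1)) ^ 2 *
            (Real.log (1 / ε) ^ 2 * Real.log (1 / β) * Real.log (1 / δ) / ε ^ 2))) ω.2 ω.1} ∧
        (α ≤ 1 → ENNReal.ofReal (1 - δ) ≤ fullLaw p α β δ {ω | RejectsWithin c₀ α β δ
          (K * (Real.log (1 / ε) ^ 2 * Real.log (1 / β) * Real.log (1 / δ) /
            (α ^ 2 * ε ^ 2))) ω.2 ω.1})) := by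
  refine ⟨fun k c₀ α β δ hα hβ hβ1 _ _ => isLDP_transcript hα hβ hβ1,
    fun k p c₀ α β δ _ _ _ hδ hδ1 h => never_rejects p hδ hδ1 h, fun κ hκ hκ1 => ?_⟩
  obtain ⟨K, hK, hrej⟩ := exists_sample_bound hκ hκ1
  -- The 16 comes from `exp_ratio_sq_le` and is needed only for the bound with `α ≤ 1`; the first
  -- bound has room for it.
  refine ⟨16 * K, by positivity, ?_⟩
  intro k p c₀ α β δ ε hα hβ hβκ hδ hδκ hε hεκ h
  have hlog : ∀ y : ℝ, 0 < y → y ≤ κ → 0 ≤ Real.log (1 / y) := fun y hy hyκ =>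
    log_one_div_nonneg hy (hyκ.trans hκ1.le)
  have hβ0 := hlog β hβ hβκ
  have hδ0 := hlog δ hδ hδκ
  refine ⟨hrej k p c₀ α β δ ε _ hα hβ hβκ hδ hδκ hε hεκ h ?_, fun hα1 =>
    hrej k p c₀ α β δ ε _ hα hβ hβκ hδ hδκ hε hεκ h ?_⟩
  · gcongr
    linarith
  · calc _ ≤ K * (16 / α ^ 2 *
          (Real.log (1 / ε) ^ 2 * Real.log (1 / β) * Real.log (1 / δ) / ε ^ 2)) := by
          gcongr
          exact exp_ratio_sq_le hα hα1
      _ = _ := by field_simp
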